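/- A matchstick graph is a finite simple graph drawn in the Euclidean plane so that its vertices are distinct points, its edges are straight-line segments of length $1$ joining their end-vertices, and any two distinct edges intersect only at common endpoints; isolated vertices are allowed. In any matchstick graph on $n \ge 1$ vertices, the number of vertices of degree at most $4$ is greater than $\frac14\sqrt{\pi\sqrt3\cdot n}$. This bound is sharp up to the constant: there is a constant $C>0$ such that for every $n$ there is a matchstick graph on $n$ vertices with at most $C\sqrt n$ vertices of degree at most $4$. -/

import Mathlib

/-- `IsMatchstickDrawing G p`: placing the vertices of `G` at the points `p v` and drawing every
edge as a straight-line segment gives a plane drawing of `G` all of whose edges have length `1`.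
Two different edges may meet only in a common endpoint. -/
structure IsMatchstickDrawing {V : Type*} (G : SimpleGraph V)
    (p : V → EuclideanSpace ℝ (Fin 2)) : Prop where
  /-- The vertices are distinct points. -/
  injective : Function.Injective p
  /-- Every edge has unit length. -/
  unit_length : ∀ u v : V, G.Adj u v → dist (p u) (p v) = 1
  /-- Different edges intersect only at (necessarily common) endpoints. -/
  crossing_free : ∀ u v x y : V, G.Adj u v → G.Adj x y → s(u, v) ≠ s(x, y) →
    segment ℝ (p u) (p v) ∩ segment ℝ (p x) (p y) ⊆ p '' (({u, v} : Set V) ∩ {x, y})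

/-- A graph is a matchstick graph if it has a matchstick drawing in the Euclidean plane. -/
def IsMatchstickGraph {V : Type*} (G : SimpleGraph V) : Prop :=
  ∃ p : V → EuclideanSpace ℝ (Fin 2), IsMatchstickDrawing G p

/-! Discard the isolated vertices and enlarge the edge set of G to a maximal straight-line plane
drawing T on the same points. In T, two consecutive edges at a vertex that make an angle less than π
span an empty triangle (`IsPlaneDrawing.adj_of_consecutive`, `IsRotation.exists_triangle`). Gluing
these triangles along the edges outside G recovers faces of G; all darts outside triangles, and
whatever is glued to them, form one outer face O. Faces enter only through angle sums and the
spanning-tree bound `two_mul_card_supp_le`, so neither Euler's formula nor the Jordan curve theorem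
is needed.

Let n be the number of remaining vertices, m the number of those of degree at most 4, k the number
of G-darts of O, and s the number of inner faces that are unit triangles. Three facts are combined.

(1) k ≤ 4m (`IsMerging.card_outer_le`), by discharging. Angles are measured in units of π/3 and an
angle y carries the charge `excess y`, which is 0 on [1, 2], y - 1 below and y - 2 above. The angles
around a vertex add up to 6, so its charge is at most 0 if the degree is at least 5 and at most 4
otherwise. An inner face has nonnegative charge: its angle sum shows this except for unit triangles,
rhombi and pentagons, which are treated separately. The outer angles average at least 3, so O has
charge at least k.

(2) The degree sum plus k is at most 4n + s (`IsMerging.card_darts_le`), by comparing sides with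
angles face by face. Since the degree sum is at least 5n - 4m, this gives n + k ≤ 4m + s.

(3) If s > 0 then π√3·s < k² (`IsMerging.card_mul_lt`): unit triangles of total area s√3/4 are
enclosed by closed walks of total length k, and the isoperimetric inequality applies.

Eliminating s gives π√3·n < k² + π√3(4m - k), and with k ≤ 4m this forces 4m > √(π√3·n)
(`quarter_sqrt_lt_of_counts`). Isolated vertices are restored by subadditivity of the square root.
For sharpness, take about √n rows of √n points of the triangular lattice, where only vertices near
the rim have degree at most 4. -/

/-- The determinant of two complex numbers, regarded as plane vectors. -/
noncomputable def planeDet (a b : ℂ) : ℝ := (starRingEnd ℂ a * b).im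

lemma planeDet_apply (a b : ℂ) : planeDet a b = a.re * b.im - a.im * b.re := by
  simp [planeDet, Complex.mul_im]; ring

lemma planeDet_swap (a b : ℂ) : planeDet a b = -planeDet b a := by
  simp only [planeDet_apply]; ring

/-! ### Isoperimetric inequality for closed polygons, by finite Fourier analysis. -/

namespace ZMod

variable {N : ℕ} [NeZero N]

/-- Parseval in polarized form: twice the area of a polygon is the imaginary part of the pairing of
`f` with its shift, and the sum of squared side lengths is the pairing of the difference with
itself, so both become diagonal in frequency. -/
lemma sum_conj_mul_eq_dft (f g : ZMod N → ℂ) :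
    ∑ j, starRingEnd ℂ (f j) * g j = (N : ℂ)⁻¹ * ∑ h, starRingEnd ℂ (dft f h) * dft g h := by
  have hg : ∀ j, g j = (N : ℂ)⁻¹ * ∑ h, stdAddChar (h * j) * dft g h := by
    intro j
    conv_lhs => rw [← LinearEquiv.symm_apply_apply dft g]
    rw [invDFT_apply]
    simp
  have hf : ∀ h, starRingEnd ℂ (dft f h) =
      ∑ j, stdAddChar (h * j) * starRingEnd ℂ (f j) := by
    intro h
    rw [dft_apply, map_sum]
    refine Finset.sum_congr rfl fun j _ => ?_
    rw [smul_eq_mul, map_mul, AddChar.map_neg_eq_conj, Complex.conj_conj, mul_comm h]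
  simp_rw [hf]
  generalize dft g = γ at hg
  simp_rw [hg, Finset.mul_sum, Finset.sum_mul, Finset.mul_sum]
  rw [Finset.sum_comm]
  refine Finset.sum_congr rfl fun h _ => Finset.sum_congr rfl fun j _ => ?_
  ring

lemma dft_shift (f : ZMod N → ℂ) (h : ZMod N) :
    dft (fun j => f (j + 1)) h = stdAddChar h * dft f h := by
  rw [dft_apply, dft_apply, Finset.mul_sum]
  rw [← Equiv.sum_comp (Equiv.subRight (1 : ZMod N))]
  refine Finset.sum_congr rfl fun j _ => ?_
  simp only [Equiv.subRight_apply, sub_add_cancel, smul_eq_mul]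
  rw [← mul_assoc, ← AddChar.map_add_eq_mul]
  congr 2
  ring

lemma stdAddChar_re_im (h : ZMod N) :
    (stdAddChar h).re = Real.cos (2 * (Real.pi * h.val / N)) ∧
    (stdAddChar h).im = Real.sin (2 * (Real.pi * h.val / N)) := by
  have : (stdAddChar h : ℂ) = Complex.exp ((2 * (Real.pi * h.val / N) : ℝ) * Complex.I) := by
    have := stdAddChar_coe (N := N) (h.val : ℤ)
    rw [Int.cast_natCast, natCast_zmod_val] at this
    rw [this]
    congr 1
    push_cast
    ring
  rw [this, Complex.exp_ofReal_mul_I_re, Complex.exp_ofReal_mul_I_im]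
  exact ⟨rfl, rfl⟩

/-- The discrete isoperimetric inequality for closed polygons with `N ≤ M` sides. -/
lemma sin_mul_sum_planeDet_le (f : ZMod N → ℂ) {M : ℕ} (hM : N ≤ M) :
    Real.sin (Real.pi / M) * ∑ j, planeDet (f j) (f (j + 1)) ≤
      Real.cos (Real.pi / M) / 2 * ∑ j, ‖f (j + 1) - f j‖ ^ 2 := by
  have hN : 0 < N := Nat.pos_of_ne_zero (NeZero.ne N)
  have h1 : ∑ j, planeDet (f j) (f (j + 1)) =
      (N : ℝ)⁻¹ * ∑ h, (stdAddChar h).im * ‖dft f h‖ ^ 2 := by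
    have := congrArg Complex.im (sum_conj_mul_eq_dft f (fun j => f (j + 1)))
    rw [Complex.im_sum] at this
    unfold planeDet
    rw [this]
    have h2 : ∀ h, starRingEnd ℂ (dft f h) * dft (fun j => f (j + 1)) h =
        stdAddChar h * ((‖dft f h‖ ^ 2 : ℝ) : ℂ) := by
      intro h
      rw [dft_shift, Complex.ofReal_pow, ← Complex.conj_mul']
      ring
    simp_rw [h2]
    have h3 : ((N : ℂ)⁻¹) = (((N : ℝ)⁻¹ : ℝ) : ℂ) := by push_cast; rfl
    rw [h3, Complex.im_ofReal_mul, Complex.im_sum]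
    simp_rw [Complex.im_mul_ofReal]
  have h4 : ∑ j, ‖f (j + 1) - f j‖ ^ 2 =
      (N : ℝ)⁻¹ * ∑ h, (2 - 2 * (stdAddChar h).re) * ‖dft f h‖ ^ 2 := by
    have := congrArg Complex.re
      (sum_conj_mul_eq_dft (fun j => f (j + 1) - f j) (fun j => f (j + 1) - f j))
    rw [Complex.re_sum] at this
    have h5 : ∀ h, dft (fun j => f (j + 1) - f j) h = (stdAddChar h - 1) * dft f h := by
      intro h
      have : (fun j => f (j + 1) - f j) = (fun j => f (j + 1)) - f := rfl
      rw [this, map_sub, Pi.sub_apply, dft_shift]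
      ring
    simp_rw [h5, Complex.conj_mul', norm_mul, ← Complex.ofReal_pow, Complex.ofReal_re] at this
    rw [this]
    have h3 : ((N : ℂ)⁻¹) = (((N : ℝ)⁻¹ : ℝ) : ℂ) := by push_cast; rfl
    rw [h3, Complex.re_ofReal_mul, Complex.re_sum]
    congr 1
    refine Finset.sum_congr rfl fun h _ => ?_
    rw [Complex.ofReal_re, mul_pow, ← Complex.normSq_eq_norm_sq (_ - 1), Complex.normSq_apply]
    have := Real.cos_sq_add_sin_sq (2 * (Real.pi * h.val / N))
    simp only [Complex.sub_re, Complex.sub_im, Complex.one_re, Complex.one_im,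
      (stdAddChar_re_im h).1, (stdAddChar_re_im h).2]
    congr 1
    linear_combination this
  rw [h1, h4, mul_left_comm, mul_left_comm (Real.cos (Real.pi / M) / 2)]
  refine mul_le_mul_of_nonneg_left ?_ (by positivity)
  rw [Finset.mul_sum, Finset.mul_sum]
  refine Finset.sum_le_sum fun h _ => ?_
  rw [← mul_assoc, ← mul_assoc]
  refine mul_le_mul_of_nonneg_right ?_ (by positivity)
  rw [(stdAddChar_re_im h).1, (stdAddChar_re_im h).2]
  set θ := Real.pi * h.val / N with hθ
  set η := Real.pi / M with hη
  rw [Real.sin_two_mul, Real.cos_two_mul]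
  have hlt : (h.val : ℝ) < N := by exact_mod_cast h.val_lt
  have hN' : (0 : ℝ) < N := by exact_mod_cast hN
  have hMN : (N : ℝ) ≤ M := by exact_mod_cast hM
  have hθ0 : 0 ≤ θ := by positivity
  have hθ1 : θ < Real.pi := by
    rw [hθ, div_lt_iff₀ hN']
    exact mul_lt_mul_of_pos_left hlt Real.pi_pos
  have hs : 0 ≤ Real.sin θ := Real.sin_nonneg_of_nonneg_of_le_pi hθ0 hθ1.le
  -- At frequency `h` the right side minus the left side is 2 sin θ sin(θ - η). It vanishes for h =
  -- 0, and for h ≥ 1 one has θ ≥ π/N ≥ π/M = η; this is where `N ≤ M` enters.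
  have key : 0 ≤ Real.sin θ * Real.sin (θ - η) := by
    rcases Nat.eq_zero_or_pos h.val with h0 | h0
    · simp [hθ, h0]
    · refine mul_nonneg hs (Real.sin_nonneg_of_nonneg_of_le_pi ?_ ?_)
      · have : (1 : ℝ) ≤ h.val := by exact_mod_cast h0
        have : η ≤ θ := by
          rw [hη, hθ]
          gcongr
          nlinarith [Real.pi_pos]
        linarith
      · have : 0 ≤ η := by positivity
        linarith
  rw [Real.sin_sub] at key
  have : Real.cos θ ^ 2 = 1 - Real.sin θ ^ 2 := by rw [← Real.sin_sq_add_cos_sq θ]; ring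
  rw [this]
  linarith

end ZMod

/-- The isoperimetric inequality for a family of closed polygons with unit sides, given by a
permutation of the vertices. -/
lemma sin_mul_sum_planeDet_perm_le {S : Type*} [Fintype S] (σ : Equiv.Perm S) (w : S → ℂ)
    (hw : ∀ s, ‖w (σ s) - w s‖ = 1) :
    Real.sin (Real.pi / Fintype.card S) * ∑ s, planeDet (w s) (w (σ s)) ≤
      Real.cos (Real.pi / Fintype.card S) / 2 * Fintype.card S := by
  classical
  set n := Fintype.card S with hn
  -- Every cycle length divides `n!`, so `n!` steps from any point run round its cycle a whole
  -- number of times. Summed over all starting points, each side is counted `n!` times, and no cycle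
  -- decomposition of `σ` is needed.
  set M := n.factorial with hM
  have hM0 : (0 : ℝ) < M := by exact_mod_cast n.factorial_pos
  have hper : ∀ s, ∃ c, 0 < c ∧ c ≤ n ∧ (σ ^ c) s = s := by
    intro s
    refine ⟨Function.minimalPeriod σ s, Function.minimalPeriod_pos_of_mem_periodicPts ?_, ?_, ?_⟩
    · exact Function.Injective.mem_periodicPts σ.injective s
    · exact Function.minimalPeriod_le_card
    · have := Function.iterate_minimalPeriod (f := σ) (x := s)
      rwa [Equiv.Perm.iterate_eq_pow] at this
  have horb : ∀ s, Real.sin (Real.pi / n) *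
      ∑ j ∈ Finset.range M, planeDet (w ((σ ^ j) s)) (w ((σ ^ (j + 1)) s)) ≤
      Real.cos (Real.pi / n) / 2 * M := by
    intro s
    obtain ⟨c, hc, hcn, hcs⟩ := hper s
    have : NeZero c := ⟨hc.ne'⟩
    have hcq : ∀ q j, (σ ^ (c * q + j)) s = (σ ^ j) s := by
      intro q
      induction q with
      | zero => simp
      | succ q ih =>
        intro j
        rw [show c * (q + 1) + j = (c * q + j) + c by ring, pow_add, Equiv.Perm.mul_apply, hcs, ih]
    have hmod : ∀ j, (σ ^ (j % c)) s = (σ ^ j) s := by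
      intro j
      conv_rhs => rw [← Nat.div_add_mod j c, hcq]
    have hone : Real.sin (Real.pi / n) *
        ∑ j ∈ Finset.range c, planeDet (w ((σ ^ j) s)) (w ((σ ^ (j + 1)) s)) ≤
        Real.cos (Real.pi / n) / 2 * c := by
      -- Since `c ≤ n`, all cycles may use the constant belonging to `n` sides; with a common
      -- constant their inequalities add up.
      have := ZMod.sin_mul_sum_planeDet_le (fun j : ZMod c => w ((σ ^ j.val) s)) hcn
      have hsucc : ∀ j : ZMod c, (σ ^ (j + 1).val) s = (σ ^ (j.val + 1)) s := by
        intro j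
        rw [ZMod.val_add, ZMod.val_one_eq_one_mod, Nat.add_mod_mod, hmod]
      simp only [hsucc] at this
      have hnorm : ∀ j : ZMod c, ‖w ((σ ^ (j.val + 1)) s) - w ((σ ^ j.val) s)‖ = 1 := by
        intro j
        rw [pow_succ', Equiv.Perm.mul_apply]
        exact hw _
      simp only [hnorm, one_pow, Finset.sum_const, Finset.card_univ, ZMod.card, nsmul_eq_mul,
        mul_one] at this
      convert this using 2
      refine Finset.sum_nbij' (fun j => (j : ZMod c)) (fun j => j.val) ?_ ?_ ?_ ?_ ?_
      · simp
      · simp [ZMod.val_lt]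
      · intro j hj
        exact ZMod.val_cast_of_lt (Finset.mem_range.1 hj)
      · simp
      · intro j hj
        simp only [ZMod.val_cast_of_lt (Finset.mem_range.1 hj)]
    obtain ⟨q, hq⟩ : c ∣ M := Nat.dvd_factorial hc hcn
    rw [hq]
    clear hq
    induction q with
    | zero => simp
    | succ q ih =>
      rw [Nat.mul_succ, Finset.sum_range_add, mul_add]
      simp only [add_assoc, hcq]
      simp only [Nat.cast_add, Nat.cast_mul] at ih ⊢
      linarith
  have hsum : ∑ s, ∑ j ∈ Finset.range M, planeDet (w ((σ ^ j) s)) (w ((σ ^ (j + 1)) s)) =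
      M * ∑ s, planeDet (w s) (w (σ s)) := by
    rw [Finset.sum_comm]
    have : ∀ j, ∑ s, planeDet (w ((σ ^ j) s)) (w ((σ ^ (j + 1)) s)) =
        ∑ s, planeDet (w s) (w (σ s)) := by
      intro j
      simp only [pow_succ', Equiv.Perm.mul_apply]
      exact Equiv.sum_comp (σ ^ j) (fun s => planeDet (w s) (w (σ s)))
    simp [this]
  have htot := Finset.sum_le_sum fun s (_ : s ∈ Finset.univ) => horb s
  rw [← Finset.mul_sum, hsum, Finset.sum_const, Finset.card_univ, ← hn, nsmul_eq_mul] at htot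
  refine le_of_mul_le_mul_left ?_ hM0
  linarith

/-- The bound (n/2)·cot(π/n) is below n²/(2π) because tan η > η. The case n = 2 is separate, since
π/2 is outside the range of that inequality; there the cosine is 0. -/
lemma sum_planeDet_perm_lt {S : Type*} [Fintype S] [Nonempty S] (σ : Equiv.Perm S) (w : S → ℂ)
    (hw : ∀ s, ‖w (σ s) - w s‖ = 1) :
    ∑ s, planeDet (w s) (w (σ s)) < (Fintype.card S : ℝ) ^ 2 / (2 * Real.pi) := by
  have h := sin_mul_sum_planeDet_perm_le σ w hw
  obtain ⟨s⟩ := ‹Nonempty S›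
  have hne : ∀ t, σ t ≠ t := by
    intro t ht
    have := hw t
    rw [ht, sub_self, norm_zero] at this
    exact zero_ne_one this
  have h2 : 2 ≤ Fintype.card S := by
    have : Nontrivial S := ⟨⟨_, _, hne s⟩⟩
    exact Fintype.one_lt_card
  set n := Fintype.card S
  have hn2 : (2 : ℝ) ≤ n := by exact_mod_cast h2
  have hpi := Real.pi_pos
  rcases h2.eq_or_lt with h2 | h3
  · rw [← h2] at h ⊢
    simp only [Nat.cast_ofNat, Real.sin_pi_div_two, Real.cos_pi_div_two] at h
    have : 0 < (2 : ℝ) ^ 2 / (2 * Real.pi) := by positivity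
    push_cast
    linarith
  · have hn3 : (3 : ℝ) ≤ n := by exact_mod_cast h3
    set η := Real.pi / n with hη
    have hη0 : 0 < η := by positivity
    have hη1 : η < Real.pi / 2 := by
      rw [hη]
      gcongr
      linarith
    have hcos : 0 < Real.cos η := Real.cos_pos_of_mem_Ioo ⟨by linarith, hη1⟩
    have hsin : 0 < Real.sin η := Real.sin_pos_of_pos_of_lt_pi hη0 (by linarith)
    have htan := Real.lt_tan hη0 hη1
    rw [Real.tan_eq_sin_div_cos, lt_div_iff₀ hcos] at htan
    rw [lt_div_iff₀ (by positivity)]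
    refine lt_of_mul_lt_mul_left ?_ hsin.le
    have e : Real.pi = η * n := by rw [hη]; field_simp
    calc Real.sin η * ((∑ s, planeDet (w s) (w (σ s))) * (2 * Real.pi))
        ≤ Real.cos η / 2 * n * (2 * Real.pi) := by
          rw [← mul_assoc]
          exact mul_le_mul_of_nonneg_right h (by positivity)
      _ = η * Real.cos η * (n * n) := by rw [e]; ring
      _ < Real.sin η * (n * n) := by gcongr
      _ = Real.sin η * n ^ 2 := by ring

/-! ### Counterclockwise angles and the cyclic order of directions. -/

open Real in
/-- The counterclockwise angle from `a` to `b`, in `(0, 2π]`. -/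
noncomputable def ccwAngle (a b : ℂ) : ℝ :=
  toIocMod two_pi_pos 0 (Complex.arg b - Complex.arg a)

section ccwAngle

variable {a b c : ℂ}

lemma ccwAngle_pos : 0 < ccwAngle a b := (toIocMod_mem_Ioc Real.two_pi_pos 0 _).1

lemma ccwAngle_le : ccwAngle a b ≤ 2 * Real.pi :=
  (toIocMod_mem_Ioc Real.two_pi_pos 0 _).2.trans (zero_add _).le

lemma exists_ccwAngle_eq (a b : ℂ) :
    ∃ n : ℤ, ccwAngle a b = Complex.arg b - Complex.arg a + n * (2 * Real.pi) := by
  refine ⟨-toIocDiv Real.two_pi_pos 0 (Complex.arg b - Complex.arg a), ?_⟩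
  have := toIocMod_add_toIocDiv_zsmul Real.two_pi_pos 0 (Complex.arg b - Complex.arg a)
  rw [zsmul_eq_mul] at this
  push_cast
  unfold ccwAngle
  linarith

lemma norm_mul_sin_ccwAngle (a b : ℂ) :
    ‖a‖ * ‖b‖ * Real.sin (ccwAngle a b) = planeDet a b := by
  obtain ⟨n, hn⟩ := exists_ccwAngle_eq a b
  rw [hn, Real.sin_add_int_mul_two_pi, Real.sin_sub, planeDet_apply]
  have ha1 := Complex.norm_mul_cos_arg a
  have ha2 := Complex.norm_mul_sin_arg a
  have hb1 := Complex.norm_mul_cos_arg b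
  have hb2 := Complex.norm_mul_sin_arg b
  rw [← ha1, ← ha2, ← hb1, ← hb2]
  simp only [Complex.norm_mul_cos_arg, Complex.norm_mul_sin_arg]
  linear_combination (‖b‖ * Real.sin b.arg) * ha1 - (‖b‖ * Real.cos b.arg) * ha2 +
    a.re * hb2 - a.im * hb1

lemma ccwAngle_lt_pi_iff (ha : a ≠ 0) (hb : b ≠ 0) :
    ccwAngle a b < Real.pi ↔ 0 < planeDet a b := by
  rw [← norm_mul_sin_ccwAngle]
  have hab : 0 < ‖a‖ * ‖b‖ := by positivity
  rw [mul_pos_iff_of_pos_left hab]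
  constructor
  · exact fun h => Real.sin_pos_of_pos_of_lt_pi ccwAngle_pos h
  · intro h
    by_contra hc
    push Not at hc
    have h1 := Real.sin_nonneg_of_nonneg_of_le_pi (x := ccwAngle a b - Real.pi) (by linarith)
      (by linarith [ccwAngle_le (a := a) (b := b)])
    rw [Real.sin_sub_pi] at h1
    linarith

/-- The angle from `a` to `b` plus that from `b` to `c` differs from that from `a` to `c` by a
multiple of 2π. All three lie in (0, π), so this multiple is 0. -/
lemma ccwAngle_lt_of_planeDet_pos (h1 : 0 < planeDet a b) (h2 : 0 < planeDet b c)
    (h3 : 0 < planeDet a c) : ccwAngle a b < ccwAngle a c := by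
  have ha : a ≠ 0 := by rintro rfl; simp [planeDet] at h1
  have hb : b ≠ 0 := by rintro rfl; simp [planeDet] at h1
  have hc : c ≠ 0 := by rintro rfl; simp [planeDet] at h2
  rw [← ccwAngle_lt_pi_iff ha hb] at h1
  rw [← ccwAngle_lt_pi_iff hb hc] at h2
  rw [← ccwAngle_lt_pi_iff ha hc] at h3
  obtain ⟨n1, e1⟩ := exists_ccwAngle_eq a b
  obtain ⟨n2, e2⟩ := exists_ccwAngle_eq b c
  obtain ⟨n3, e3⟩ := exists_ccwAngle_eq a c
  have p1 := ccwAngle_pos (a := a) (b := b)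
  have p2 := ccwAngle_pos (a := b) (b := c)
  have p3 := ccwAngle_pos (a := a) (b := c)
  have hpi := Real.pi_pos
  have e : ccwAngle a b + ccwAngle b c - ccwAngle a c = ((n1 + n2 - n3 : ℤ) : ℝ) * (2 * Real.pi) := by
    rw [e1, e2, e3]; push_cast; ring
  have l1 : ((n1 + n2 - n3 : ℤ) : ℝ) < 1 := by
    by_contra h
    push Not at h
    nlinarith
  have l2 : (-1 : ℝ) < ((n1 + n2 - n3 : ℤ) : ℝ) := by
    by_contra h
    push Not at h
    nlinarith
  have : n1 + n2 - n3 = 0 := by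
    have : n1 + n2 - n3 < 1 := by exact_mod_cast l1
    have : -1 < n1 + n2 - n3 := by exact_mod_cast l2
    omega
  rw [this] at e
  simp at e
  linarith

/-- The angle `ccwAngle` in terms of the unoriented angle. -/
lemma ccwAngle_eq_angle (h : 0 < planeDet a b) :
    ccwAngle a b = InnerProductGeometry.angle a b := by
  have ha : a ≠ 0 := by rintro rfl; simp [planeDet] at h
  have hb : b ≠ 0 := by rintro rfl; simp [planeDet] at h
  have h1 := (ccwAngle_lt_pi_iff ha hb).2 h
  have hcos : Real.cos (ccwAngle a b) = Real.cos (InnerProductGeometry.angle a b) := by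
    obtain ⟨n, hn⟩ := exists_ccwAngle_eq a b
    have hab : (‖a‖ * ‖b‖) ≠ 0 := by positivity
    refine mul_left_cancel₀ hab ?_
    rw [mul_comm _ (Real.cos (InnerProductGeometry.angle a b)),
      InnerProductGeometry.cos_angle_mul_norm_mul_norm, hn, Real.cos_add_int_mul_two_pi,
      Real.cos_sub, Complex.inner]
    have ha1 := Complex.norm_mul_cos_arg a
    have ha2 := Complex.norm_mul_sin_arg a
    have hb1 := Complex.norm_mul_cos_arg b
    have hb2 := Complex.norm_mul_sin_arg b
    simp only [Complex.mul_re, Complex.conj_re, Complex.conj_im]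
    linear_combination (‖b‖ * Real.cos b.arg) * ha1 + (‖b‖ * Real.sin b.arg) * ha2 +
      a.re * hb1 + a.im * hb2
  exact Real.injOn_cos ⟨ccwAngle_pos.le, h1.le⟩
    ⟨InnerProductGeometry.angle_nonneg _ _, InnerProductGeometry.angle_le_pi _ _⟩ hcos

/-- Two vectors making the same angle with `a` have the same argument. -/
lemma arg_eq_of_ccwAngle_eq (h : ccwAngle a b = ccwAngle a c) : Complex.arg b = Complex.arg c := by
  obtain ⟨n1, e1⟩ := exists_ccwAngle_eq a b
  obtain ⟨n2, e2⟩ := exists_ccwAngle_eq a c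
  have hb1 := Complex.neg_pi_lt_arg b
  have hb2 := Complex.arg_le_pi b
  have hc1 := Complex.neg_pi_lt_arg c
  have hc2 := Complex.arg_le_pi c
  have hpi := Real.pi_pos
  have e : Complex.arg b - Complex.arg c = ((n2 - n1 : ℤ) : ℝ) * (2 * Real.pi) := by
    push_cast; linarith
  have l1 : ((n2 - n1 : ℤ) : ℝ) < 1 := by
    by_contra h
    push Not at h
    nlinarith
  have l2 : (-1 : ℝ) < ((n2 - n1 : ℤ) : ℝ) := by
    by_contra h
    push Not at h
    nlinarith
  have : n2 - n1 = 0 := by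
    have : n2 - n1 < 1 := by exact_mod_cast l1
    have : -1 < n2 - n1 := by exact_mod_cast l2
    omega
  rw [this] at e
  simp at e
  linarith

lemma ccwAngle_of_arg_lt (h : Complex.arg a < Complex.arg b) :
    ccwAngle a b = Complex.arg b - Complex.arg a := by
  unfold ccwAngle
  rw [toIocMod_eq_self]
  have := Complex.arg_le_pi b
  have := Complex.neg_pi_lt_arg a
  constructor <;> linarith

lemma ccwAngle_of_arg_le (h : Complex.arg b ≤ Complex.arg a) :
    ccwAngle a b = Complex.arg b - Complex.arg a + 2 * Real.pi := by
  unfold ccwAngle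
  rw [← toIocMod_add_right, toIocMod_eq_self]
  have := Complex.arg_le_pi a
  have := Complex.neg_pi_lt_arg b
  constructor <;> linarith

end ccwAngle

/-- Finitely many vectors with different directions are cyclically ordered by argument. -/
lemma exists_ccw_perm {ι : Type*} [Fintype ι] [Nonempty ι] (f : ι → ℂ)
    (hf : Function.Injective fun i => Complex.arg (f i)) :
    ∃ σ : Equiv.Perm ι, (∀ i j, ccwAngle (f i) (f (σ i)) ≤ ccwAngle (f i) (f j)) ∧
      ∑ i, ccwAngle (f i) (f (σ i)) = 2 * Real.pi ∧
      ∀ (P : ι → Prop) (i₀ : ι), P i₀ → (∀ i, P i → P (σ i)) → ∀ i, P i := by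
  classical
  let : LinearOrder ι := LinearOrder.lift' (fun i => Complex.arg (f i)) hf
  obtain ⟨n, hn⟩ : ∃ n, Fintype.card ι = n + 1 := ⟨_, (Nat.succ_pred_eq_of_pos Fintype.card_pos).symm⟩
  let e : Fin (n + 1) ≃o ι := monoEquivOfFin ι hn
  have hlt : ∀ i j, i < j → Complex.arg (f (e i)) < Complex.arg (f (e j)) := fun i j h =>
    e.strictMono h
  have hle : ∀ i j, i ≤ j → Complex.arg (f (e i)) ≤ Complex.arg (f (e j)) := fun i j h =>
    e.monotone h
  obtain ⟨σ, hσ⟩ : ∃ σ : Equiv.Perm ι, ∀ i, σ (e i) = e (finRotate (n + 1) i) :=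
    ⟨(e.toEquiv.symm.trans (finRotate (n + 1))).trans e.toEquiv, fun i => by simp⟩
  have hs : ∀ i : Fin n, finRotate (n + 1) i.castSucc = i.succ := by
    intro i
    rw [finRotate_apply, Fin.coeSucc_eq_succ]
  refine ⟨σ, ?_, ?_, ?_⟩
  · intro i j
    obtain ⟨i, rfl⟩ := e.surjective i
    obtain ⟨j, rfl⟩ := e.surjective j
    rw [hσ]
    induction i using Fin.lastCases with
    | last =>
      -- The largest argument is followed by the smallest. With a single vector this is the angle
      -- from the vector to itself, which is 2π and not 0 by the choice of the interval (0, 2π].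
      rw [finRotate_last, ccwAngle_of_arg_le (hle _ _ (Fin.zero_le _)),
        ccwAngle_of_arg_le (hle _ _ (Fin.le_last _))]
      linarith [hle 0 j (Fin.zero_le _)]
    | cast i =>
      rw [hs, ccwAngle_of_arg_lt (hlt _ _ Fin.castSucc_lt_succ)]
      rcases lt_or_ge i.castSucc j with h | h
      · rw [ccwAngle_of_arg_lt (hlt _ _ h)]
        linarith [hle i.succ j (Fin.castSucc_lt_iff_succ_le.1 h)]
      · rw [ccwAngle_of_arg_le (hle _ _ h)]
        have := Complex.arg_le_pi (f (e i.succ))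
        have := Complex.neg_pi_lt_arg (f (e j))
        linarith
  · rw [← Equiv.sum_comp e.toEquiv]
    simp only [RelIso.coe_fn_toEquiv, hσ]
    rw [Fin.sum_univ_castSucc, finRotate_last, ccwAngle_of_arg_le (hle _ _ (Fin.zero_le _))]
    simp only [hs, ccwAngle_of_arg_lt (hlt _ _ Fin.castSucc_lt_succ)]
    rw [Finset.sum_sub_distrib]
    have h1 := Fin.sum_univ_castSucc fun i => Complex.arg (f (e i))
    have h2 := Fin.sum_univ_succ fun i => Complex.arg (f (e i))
    linarith
  · intro P i₀ h0 hstep i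
    have hstep' : ∀ i, P (e i) → P (e (finRotate (n + 1) i)) := by
      intro i hi
      rw [← hσ]
      exact hstep _ hi
    have hup : ∀ i j : Fin (n + 1), i ≤ j → P (e i) → P (e j) := by
      intro i j
      induction j using Fin.induction with
      | zero =>
        intro h
        rw [Fin.le_zero_iff.1 h]; exact id
      | succ j ih =>
        intro h hi
        rcases h.eq_or_lt with rfl | h
        · exact hi
        · have := hstep' _ (ih (Fin.le_castSucc_iff.2 h) hi)
          rwa [hs] at this
    obtain ⟨i₀, rfl⟩ := e.surjective i₀
    obtain ⟨i, rfl⟩ := e.surjective i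
    have hl := hstep' _ (hup _ _ (Fin.le_last i₀) h0)
    rw [finRotate_last] at hl
    exact hup 0 i (Fin.zero_le _) hl

/-! ### Maximal plane drawings: consecutive edges span empty triangles. -/

/-- A straight-line drawing of `T` in which an edge contains no vertices but its ends, and
different edges meet only in vertices. -/
structure IsPlaneDrawing {V : Type*} (z : V → ℂ) (T : SimpleGraph V) : Prop where
  injective : Function.Injective z
  vertex : ∀ u v x, T.Adj u v → z x ∈ segment ℝ (z u) (z v) → x = u ∨ x = v
  edge : ∀ u v x y, T.Adj u v → T.Adj x y → s(u, v) ≠ s(x, y) →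
    ∀ q ∈ segment ℝ (z u) (z v), q ∈ segment ℝ (z x) (z y) → ∃ t, q = z t

lemma mem_segment_iff_exists_add (a b q : ℂ) :
    q ∈ segment ℝ a b ↔ ∃ θ : ℝ, 0 ≤ θ ∧ θ ≤ 1 ∧ q = a + θ * (b - a) := by
  rw [segment_eq_image']
  constructor
  · rintro ⟨θ, ⟨h0, h1⟩, rfl⟩
    exact ⟨θ, h0, h1, by simp⟩
  · rintro ⟨θ, h0, h1, rfl⟩
    exact ⟨θ, ⟨h0, h1⟩, by simp⟩

section planeDet

variable (a b c : ℂ) (s : ℝ)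

lemma planeDet_lineMap_left :
    planeDet (a + s * (b - a)) c = (1 - s) * planeDet a c + s * planeDet b c := by
  simp only [planeDet_apply, Complex.add_re, Complex.add_im, Complex.re_ofReal_mul,
    Complex.im_ofReal_mul, Complex.sub_re, Complex.sub_im]
  ring

lemma planeDet_lineMap_right :
    planeDet c (a + s * (b - a)) = (1 - s) * planeDet c a + s * planeDet c b := by
  rw [planeDet_swap, planeDet_lineMap_left, planeDet_swap c a, planeDet_swap c b]
  ring

lemma planeDet_self : planeDet a a = 0 := by
  rw [planeDet_apply]; ring

lemma planeDet_zero_left : planeDet 0 a = 0 := by simp [planeDet]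

lemma planeDet_zero_right : planeDet a 0 = 0 := by simp [planeDet]

/-- Cramer's rule for the coordinates of `c` with respect to `a` and `b`. -/
lemma planeDet_mul_eq :
    (planeDet a b : ℂ) * c = planeDet c b * a + planeDet a c * b := by
  simp only [planeDet_apply]
  apply Complex.ext
  · simp only [Complex.re_ofReal_mul, Complex.add_re]; ring
  · simp only [Complex.im_ofReal_mul, Complex.add_im]; ring

end planeDet

/-- A segment that starts in the open quadrant and ends outside the closed one leaves it through one
of the two bounding rays; the sign of a·b' - b·a' tells which coordinate vanishes first. -/
lemma exists_first_exit {a b a' b' : ℝ} (ha : 0 < a) (hb : 0 < b) (h : ¬(0 ≤ a' ∧ 0 ≤ b')) :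
    ∃ s : ℝ, 0 < s ∧ s < 1 ∧ (((1 - s) * a + s * a' = 0 ∧ 0 ≤ (1 - s) * b + s * b') ∨
      ((1 - s) * b + s * b' = 0 ∧ 0 ≤ (1 - s) * a + s * a')) := by
  have key : ∀ {a b a' b' : ℝ}, 0 < a → 0 < b → a' < 0 → a * b' - b * a' ≥ 0 →
      ∃ s : ℝ, 0 < s ∧ s < 1 ∧ ((1 - s) * a + s * a' = 0 ∧ 0 ≤ (1 - s) * b + s * b') := by
    intro a b a' b' ha hb ha' hab
    have hd : 0 < a - a' := by linarith
    refine ⟨a / (a - a'), by positivity, by rw [div_lt_one hd]; linarith, ?_, ?_⟩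
    · field_simp; ring
    · have : (1 - a / (a - a')) * b + a / (a - a') * b' = (a * b' - b * a') / (a - a') := by
        field_simp; ring
      rw [this]
      positivity
  by_cases hab : 0 ≤ a * b' - b * a'
  · have ha' : a' < 0 := by
      by_contra hc
      push Not at hc
      have hb' : b' < 0 := by
        by_contra hb'
        push Not at hb'
        exact h ⟨hc, hb'⟩
      nlinarith [mul_nonneg hb.le hc, mul_pos ha (neg_pos.2 hb')]
    obtain ⟨s, h0, h1, h2⟩ := key ha hb ha' hab
    exact ⟨s, h0, h1, Or.inl h2⟩
  · have hb' : b' < 0 := by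
      by_contra hc
      push Not at hc
      have ha' : a' < 0 := by
        by_contra ha'
        push Not at ha'
        exact h ⟨ha', hc⟩
      nlinarith [mul_nonneg ha.le hc, mul_pos hb (neg_pos.2 ha')]
    obtain ⟨s, h0, h1, h2⟩ := key hb ha hb' (by linarith)
    exact ⟨s, h0, h1, Or.inr h2⟩

lemma eq_add_of_planeDet_eq_zero {a b c : ℂ} (hD : planeDet a b ≠ 0) (h : planeDet c b = 0) :
    c = ((planeDet a c / planeDet a b : ℝ) : ℂ) * b := by
  have := planeDet_mul_eq a b c
  rw [h] at this
  have hD' : (planeDet a b : ℂ) ≠ 0 := by exact_mod_cast hD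
  push_cast
  field_simp
  rw [mul_comm c]
  simpa using this

namespace IsPlaneDrawing

variable {V : Type*} {z : V → ℂ} {T : SimpleGraph V} {u v w : V}

/-- Inside an empty part of the cone at `u` between consecutive neighbours, an edge cannot end
close to `u`. -/
lemma le_of_mem_segment (hT : IsPlaneDrawing z T) (huv : T.Adj u v) (huw : T.Adj u w)
    (hD : 0 < planeDet (z v - z u) (z w - z u))
    (hcone : ∀ x, T.Adj u x →
      ¬(0 < planeDet (z x - z u) (z w - z u) ∧ 0 < planeDet (z v - z u) (z x - z u)))
    {c : ℝ} (hc : c ≤ planeDet (z v - z u) (z w - z u))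
    (hempty : ∀ x, 0 ≤ planeDet (z x - z u) (z w - z u) → 0 ≤ planeDet (z v - z u) (z x - z u) →
      planeDet (z x - z u) (z w - z u) + planeDet (z v - z u) (z x - z u) < c → x = u)
    {y y' : V} (hy : T.Adj y y') {q : ℂ} (hq : q ∈ segment ℝ (z y) (z y'))
    (hA : 0 < planeDet (q - z u) (z w - z u)) (hB : 0 < planeDet (z v - z u) (q - z u))
    (hf : planeDet (q - z u) (z w - z u) + planeDet (z v - z u) (q - z u) ≤ c) :
    c ≤ planeDet (z y - z u) (z w - z u) + planeDet (z v - z u) (z y - z u) := by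
  by_contra! hlt
  -- An edge at `u` through `q` would point into the open cone, against `hcone`.
  have hne : u ≠ y ∧ u ≠ y' := by
    obtain ⟨θ, h0, h1, rfl⟩ := (mem_segment_iff_exists_add _ _ _).1 hq
    have e : z y + θ * (z y' - z y) - z u =
        (z y - z u) + θ * ((z y' - z u) - (z y - z u)) := by ring
    rw [e, planeDet_lineMap_left] at hA
    rw [e, planeDet_lineMap_right] at hB
    constructor
    · rintro rfl
      rw [sub_self, planeDet_zero_left, mul_zero, zero_add] at hA
      rw [sub_self, planeDet_zero_right, mul_zero, zero_add] at hB
      exact hcone y' hy ⟨pos_of_mul_pos_right hA h0, pos_of_mul_pos_right hB h0⟩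
    · rintro rfl
      rw [sub_self, planeDet_zero_left, mul_zero, add_zero] at hA
      rw [sub_self, planeDet_zero_right, mul_zero, add_zero] at hB
      exact hcone y hy.symm ⟨pos_of_mul_pos_right hA (by linarith),
        pos_of_mul_pos_right hB (by linarith)⟩
  have hout : ¬(0 ≤ planeDet (z y - z u) (z w - z u) ∧ 0 ≤ planeDet (z v - z u) (z y - z u)) :=
    fun h => hne.1 (hempty y h.1 h.2 hlt).symm
  -- The end `y` is outside the closed cone, so the way from `q` to `y` leaves it through a bounding
  -- ray, at a level below `c`. Edges `uv` and `uw` reach up to level `D ≥ c` on these rays, so one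
  -- of them is crossed before its far end.
  obtain ⟨s, hs0, hs1, hs⟩ := exists_first_exit hA hB hout
  set p := q + s * (z y - q) with hp
  have hpu : p - z u = (q - z u) + s * ((z y - z u) - (q - z u)) := by rw [hp]; ring
  have hpy : p ∈ segment ℝ (z y) (z y') :=
    (convex_segment _ _).segment_subset hq (left_mem_segment ℝ _ _)
      ((mem_segment_iff_exists_add _ _ _).2 ⟨s, hs0.le, hs1.le, hp⟩)
  rw [← planeDet_lineMap_left, ← planeDet_lineMap_right, ← hpu] at hs
  have hfp : planeDet (p - z u) (z w - z u) + planeDet (z v - z u) (p - z u) < c := by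
    rw [hpu, planeDet_lineMap_left, planeDet_lineMap_right]
    nlinarith
  have finish : ∀ x, T.Adj u x → ∀ r : ℝ, 0 ≤ r → r < 1 → p - z u = r * (z x - z u) → False := by
    intro x hux r hr0 hr1 hr
    have hpx : p ∈ segment ℝ (z u) (z x) :=
      (mem_segment_iff_exists_add _ _ _).2 ⟨r, hr0, hr1.le, by rw [← hr]; ring⟩
    have hne' : s(y, y') ≠ s(u, x) := by
      intro h
      have : u ∈ s(y, y') := by rw [h]; simp
      rcases Sym2.mem_iff.1 this with h | h
      exacts [hne.1 h, hne.2 h]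
    obtain ⟨t, ht⟩ := hT.edge _ _ _ _ hy hux hne' p hpy hpx
    rcases hT.vertex u x t hux (ht ▸ hpx) with rfl | rfl
    · rcases hT.vertex y y' t hy (ht ▸ hpy) with rfl | rfl
      exacts [hne.1 rfl, hne.2 rfl]
    · rw [ht] at hr
      have h1 : (1 - (r : ℂ)) * (z t - z u) = 0 := by linear_combination hr
      rcases mul_eq_zero.1 h1 with h1 | h1
      · have : (r : ℂ) = 1 := by linear_combination -h1
        norm_cast at this
        linarith
      · exact hux.ne (hT.injective (sub_eq_zero.1 h1)).symm
  rcases hs with ⟨h0, h1⟩ | ⟨h0, h1⟩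
  · refine finish w huw _ (div_nonneg h1 hD.le) ?_ (eq_add_of_planeDet_eq_zero hD.ne' h0)
    rw [div_lt_one hD]
    linarith
  · have hD' : 0 < -planeDet (z w - z u) (z v - z u) := by rw [← planeDet_swap]; exact hD
    have hpw : planeDet (z w - z u) (p - z u) = - planeDet (p - z u) (z w - z u) :=
      planeDet_swap _ _
    refine finish v huv _ ?_ ?_ (eq_add_of_planeDet_eq_zero (a := z w - z u) (by linarith)
      (by rw [planeDet_swap, h0, neg_zero]))
    · rw [hpw, ← neg_div_neg_eq, neg_neg]
      exact div_nonneg h1 hD'.le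
    · rw [hpw, ← neg_div_neg_eq, neg_neg, div_lt_one hD', ← planeDet_swap]
      linarith

/-- Vertices that could be joined are adjacent in a maximal plane drawing. -/
lemma adj_of_maximal (hT : Maximal (IsPlaneDrawing z) T) (huv : u ≠ v)
    (hvert : ∀ x, z x ∈ segment ℝ (z u) (z v) → x = u ∨ x = v)
    (hedge : ∀ x y, T.Adj x y → s(x, y) ≠ s(u, v) → ∀ q ∈ segment ℝ (z u) (z v),
      q ∈ segment ℝ (z x) (z y) → ∃ t, q = z t) : T.Adj u v := by
  have h2 : IsPlaneDrawing z (T ⊔ SimpleGraph.edge u v) := by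
    have hadj : ∀ {x y}, (T ⊔ SimpleGraph.edge u v).Adj x y → T.Adj x y ∨ s(x, y) = s(u, v) := by
      intro x y h
      rw [SimpleGraph.sup_adj, SimpleGraph.edge_adj] at h
      rcases h with h | ⟨h, -⟩
      · exact Or.inl h
      · right
        rcases h with ⟨rfl, rfl⟩ | ⟨rfl, rfl⟩
        exacts [rfl, Sym2.eq_swap]
    have hseg : ∀ {x y}, s(x, y) = s(u, v) → segment ℝ (z x) (z y) = segment ℝ (z u) (z v) := by
      intro x y h
      rcases Sym2.eq_iff.1 h with ⟨rfl, rfl⟩ | ⟨rfl, rfl⟩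
      exacts [rfl, segment_symm ℝ _ _]
    refine ⟨hT.prop.injective, ?_, ?_⟩
    · intro a b x hab hx
      rcases hadj hab with h | h
      · exact hT.prop.vertex a b x h hx
      · rw [hseg h] at hx
        have := hvert x hx
        rcases Sym2.eq_iff.1 h with ⟨rfl, rfl⟩ | ⟨rfl, rfl⟩
        exacts [this, this.symm]
    · intro a b x y hab hxy hne q hq1 hq2
      rcases hadj hab with h | h <;> rcases hadj hxy with h' | h'
      · exact hT.prop.edge a b x y h h' hne q hq1 hq2
      · rw [hseg h'] at hq2
        exact hedge a b h (h' ▸ hne) q hq2 hq1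
      · rw [hseg h] at hq1
        exact hedge x y h' (h ▸ hne.symm) q hq1 hq2
      · exact absurd (h.trans h'.symm) hne
  have := hT.le_of_ge h2 le_sup_left
  apply this
  rw [SimpleGraph.sup_adj, SimpleGraph.edge_adj]
  exact Or.inr ⟨Or.inl ⟨rfl, rfl⟩, huv⟩

end IsPlaneDrawing

namespace IsPlaneDrawing

variable {V : Type*} {z : V → ℂ} {T : SimpleGraph V} {u v w : V}

/-- In a maximal plane drawing, the triangle spanned by two consecutive edges at `u` contains no
further vertices. -/
lemma eq_of_mem_triangle [Finite V] (hT : Maximal (IsPlaneDrawing z) T)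
    (huv : T.Adj u v) (huw : T.Adj u w) (hD : 0 < planeDet (z v - z u) (z w - z u))
    (hcone : ∀ x, T.Adj u x →
      ¬(0 < planeDet (z x - z u) (z w - z u) ∧ 0 < planeDet (z v - z u) (z x - z u)))
    (x : V) (hA : 0 ≤ planeDet (z x - z u) (z w - z u))
    (hB : 0 ≤ planeDet (z v - z u) (z x - z u))
    (hf : planeDet (z x - z u) (z w - z u) + planeDet (z v - z u) (z x - z u) ≤
      planeDet (z v - z u) (z w - z u)) : x = u ∨ x = v ∨ x = w := by
  by_contra hx
  -- `A / D` and `B / D` are the coordinates at `u` along `v` and `w`; `A + B` is a level that is 0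
  -- at `u` and `D` on the line `vw`.
  set A : V → ℝ := fun x => planeDet (z x - z u) (z w - z u) with hAdef
  set B : V → ℝ := fun x => planeDet (z v - z u) (z x - z u) with hBdef
  set D := planeDet (z v - z u) (z w - z u) with hDdef
  have hAv : A v = D := rfl
  have hBw : B w = D := rfl
  have hAw : A w = 0 := planeDet_self _
  have hBv : B v = 0 := planeDet_self _
  -- A further vertex of lowest level in the triangle can be joined to `u` without crossings.
  -- Maximality makes it a neighbour inside the cone, against `hcone`.
  obtain ⟨x, ⟨hxA, hxB, hxf, hxn⟩, hmin⟩ := Set.exists_min_image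
    {x | 0 ≤ A x ∧ 0 ≤ B x ∧ A x + B x ≤ D ∧ ¬(x = u ∨ x = v ∨ x = w)} (fun x => A x + B x)
    (Set.toFinite _) ⟨x, hA, hB, hf, hx⟩
  push Not at hxn
  have hA0 : 0 < A x := by
    refine hxA.lt_of_ne fun h0 => ?_
    have := eq_add_of_planeDet_eq_zero hD.ne' h0.symm
    have hseg : z x ∈ segment ℝ (z u) (z w) :=
      (mem_segment_iff_exists_add _ _ _).2 ⟨B x / D, div_nonneg hxB hD.le,
        by rw [div_le_one hD]; linarith, by rw [← this]; ring⟩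
    rcases hT.prop.vertex u w x huw hseg with h | h
    exacts [hxn.1 h, hxn.2.2 h]
  have hB0 : 0 < B x := by
    refine hxB.lt_of_ne fun h0 => ?_
    have hD' : 0 < -planeDet (z w - z u) (z v - z u) := by rw [← planeDet_swap]; exact hD
    have h1 : planeDet (z w - z u) (z x - z u) = - A x := planeDet_swap _ _
    have h2 : planeDet (z w - z u) (z v - z u) = - D := planeDet_swap _ _
    have := eq_add_of_planeDet_eq_zero (a := z w - z u) (b := z v - z u)
      (c := z x - z u) (by linarith)
      (by rw [planeDet_swap]; exact neg_eq_zero.2 h0.symm)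
    rw [h1, h2, neg_div_neg_eq] at this
    have hseg : z x ∈ segment ℝ (z u) (z v) :=
      (mem_segment_iff_exists_add _ _ _).2 ⟨A x / D, div_nonneg hxA hD.le,
        by rw [div_le_one hD]; linarith, by rw [← this]; ring⟩
    rcases hT.prop.vertex u v x huv hseg with h | h
    exacts [hxn.1 h, hxn.2.1 h]
  have hval : ∀ θ : ℝ, ∀ q : ℂ, q = z u + θ * (z x - z u) →
      planeDet (q - z u) (z w - z u) = θ * A x ∧ planeDet (z v - z u) (q - z u) = θ * B x := by
    rintro θ q rfl
    have e : z u + θ * (z x - z u) - z u = 0 + θ * ((z x - z u) - 0) := by ring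
    rw [e, planeDet_lineMap_left, planeDet_lineMap_right, planeDet_zero_left, planeDet_zero_right]
    constructor <;> simp [hAdef, hBdef]
  have hempty : ∀ t, 0 ≤ A t → 0 ≤ B t → A t + B t < A x + B x → t = u := by
    intro t htA htB htf
    by_contra hne
    have : ¬(t = u ∨ t = v ∨ t = w) := by
      rintro (h | rfl | rfl)
      · exact hne h
      · linarith
      · linarith
    have := hmin t ⟨htA, htB, by linarith, this⟩
    exact absurd htf (not_lt.2 this)
  refine hcone x ?_ ⟨hA0, hB0⟩
  refine adj_of_maximal hT (Ne.symm hxn.1) ?_ ?_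
  · intro t ht
    by_contra! hne
    obtain ⟨θ, h0, h1, hq⟩ := (mem_segment_iff_exists_add _ _ _).1 ht
    have hθ1 : θ < 1 := by
      refine h1.lt_of_ne ?_
      rintro rfl
      exact hne.2 (hT.prop.injective (by rw [hq]; push_cast; ring))
    obtain ⟨e1, e2⟩ := hval θ _ hq
    refine hne.1 (hempty t ?_ ?_ ?_)
    · change 0 ≤ planeDet _ _
      rw [e1]; positivity
    · change 0 ≤ planeDet _ _
      rw [e2]; positivity
    · change planeDet _ _ + planeDet _ _ < _
      rw [e1, e2]; nlinarith
  · intro y y' hy hne q hq1 hq2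
    by_contra hno
    obtain ⟨θ, h0, h1, hq⟩ := (mem_segment_iff_exists_add _ _ _).1 hq1
    have hθ0 : 0 < θ := by
      refine h0.lt_of_ne ?_
      rintro rfl
      exact hno ⟨u, by rw [hq]; push_cast; ring⟩
    have hθ1 : θ < 1 := by
      refine h1.lt_of_ne ?_
      rintro rfl
      exact hno ⟨x, by rw [hq]; push_cast; ring⟩
    obtain ⟨e1, e2⟩ := hval θ _ hq
    have hy1 := hT.prop.le_of_mem_segment huv huw hD hcone hxf hempty hy hq2
      (by rw [e1]; positivity) (by rw [e2]; positivity) (by rw [e1, e2]; nlinarith)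
    have hy2 := hT.prop.le_of_mem_segment huv huw hD hcone hxf hempty hy.symm
      (by rw [segment_symm]; exact hq2)
      (by rw [e1]; positivity) (by rw [e2]; positivity) (by rw [e1, e2]; nlinarith)
    obtain ⟨η, h0', h1', hq'⟩ := (mem_segment_iff_exists_add _ _ _).1 hq2
    have e : q - z u = (z y - z u) + η * ((z y' - z u) - (z y - z u)) := by rw [hq']; ring
    rw [e, planeDet_lineMap_left] at e1
    rw [e, planeDet_lineMap_right] at e2
    nlinarith [mul_le_mul_of_nonneg_left hy1 (sub_nonneg.2 h1'),
      mul_le_mul_of_nonneg_left hy2 h0', mul_lt_mul_of_pos_right hθ1 hA0,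
      mul_lt_mul_of_pos_right hθ1 hB0]

/-- In a maximal plane drawing, two consecutive edges at `u` span a triangle. -/
lemma adj_of_consecutive [Finite V] (hT : Maximal (IsPlaneDrawing z) T)
    (huv : T.Adj u v) (huw : T.Adj u w) (hD : 0 < planeDet (z v - z u) (z w - z u))
    (hcone : ∀ x, T.Adj u x →
      ¬(0 < planeDet (z x - z u) (z w - z u) ∧ 0 < planeDet (z v - z u) (z x - z u))) :
    T.Adj v w := by
  have hemp := eq_of_mem_triangle hT huv huw hD hcone
  set A : ℂ → ℝ := fun x => planeDet (x - z u) (z w - z u) with hAdef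
  set B : ℂ → ℝ := fun x => planeDet (z v - z u) (x - z u) with hBdef
  set D := planeDet (z v - z u) (z w - z u) with hDdef
  have hAv : A (z v) = D := rfl
  have hBw : B (z w) = D := rfl
  have hAw : A (z w) = 0 := planeDet_self _
  have hBv : B (z v) = 0 := planeDet_self _
  have hvw : v ≠ w := by
    rintro rfl
    exact hD.ne' (planeDet_self _)
  have hval : ∀ (θ : ℝ) (a b : ℂ), A (a + θ * (b - a)) = (1 - θ) * A a + θ * A b ∧
      B (a + θ * (b - a)) = (1 - θ) * B a + θ * B b := by
    intro θ a b
    have e : a + θ * (b - a) - z u = (a - z u) + θ * ((b - z u) - (a - z u)) := by ring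
    simp only [hAdef, hBdef]
    rw [e, planeDet_lineMap_left, planeDet_lineMap_right]
    exact ⟨rfl, rfl⟩
  have hcoord : ∀ a b : ℂ, A a = A b → B a = B b → a = b := by
    intro a b h1 h2
    have ha := planeDet_mul_eq (z v - z u) (z w - z u) (a - z u)
    have hb := planeDet_mul_eq (z v - z u) (z w - z u) (b - z u)
    have e1 : planeDet (a - z u) (z w - z u) = planeDet (b - z u) (z w - z u) := h1
    have e2 : planeDet (z v - z u) (a - z u) = planeDet (z v - z u) (b - z u) := h2
    rw [e1, e2, ← hb] at ha
    have hD' : (planeDet (z v - z u) (z w - z u) : ℂ) ≠ 0 := by exact_mod_cast hD.ne'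
    have := mul_left_cancel₀ hD' ha
    linear_combination this
  have hDne := hD.ne'
  refine by_contra fun hnadj => hnadj (adj_of_maximal hT hvw ?_ ?_)
  · intro t ht
    obtain ⟨θ, h0, h1, hq⟩ := (mem_segment_iff_exists_add _ _ _).1 ht
    obtain ⟨e1, e2⟩ := hval θ (z v) (z w)
    rw [← hq, hAv, hAw] at e1
    rw [← hq, hBv, hBw] at e2
    have hfD : A (z t) + B (z t) = D := by rw [e1, e2]; ring
    rcases hemp t (show 0 ≤ A (z t) by rw [e1]; nlinarith)
      (show 0 ≤ B (z t) by rw [e2]; nlinarith) hfD.le with rfl | h | h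
    · simp only [hAdef, hBdef, sub_self, planeDet_zero_left, planeDet_zero_right] at hfD
      linarith
    · exact Or.inl h
    · exact Or.inr h
  · intro y y' hy hne q hq1 hq2
    by_contra hno
    obtain ⟨θ, h0, h1, hq⟩ := (mem_segment_iff_exists_add _ _ _).1 hq1
    have hθ0 : 0 < θ := by
      refine h0.lt_of_ne ?_
      rintro rfl
      exact hno ⟨v, by rw [hq]; push_cast; ring⟩
    have hθ1 : θ < 1 := by
      refine h1.lt_of_ne ?_
      rintro rfl
      exact hno ⟨w, by rw [hq]; push_cast; ring⟩
    obtain ⟨e1, e2⟩ := hval θ (z v) (z w)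
    rw [← hq, hAv, hAw] at e1
    rw [← hq, hBv, hBw] at e2
    have hAq : 0 < A q := by rw [e1]; nlinarith
    have hBq : 0 < B q := by rw [e2]; nlinarith
    have hfq : A q + B q = D := by rw [e1, e2]; ring
    have hempty : ∀ t, 0 ≤ A (z t) → 0 ≤ B (z t) → A (z t) + B (z t) < D → t = u := by
      intro t h1 h2 h3
      rcases hemp t h1 h2 h3.le with h | rfl | rfl
      · exact h
      · linarith
      · linarith
    have hy1 : D ≤ A (z y) + B (z y) :=
      hT.prop.le_of_mem_segment huv huw hD hcone le_rfl hempty hy hq2 hAq hBq hfq.le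
    have hy2 : D ≤ A (z y') + B (z y') :=
      hT.prop.le_of_mem_segment huv huw hD hcone le_rfl hempty hy.symm
      (by rw [segment_symm]; exact hq2) hAq hBq hfq.le
    -- The point `q` has level `D` and both ends have level at least `D`, so the edge runs along the
    -- line `vw`. No vertex lies strictly between `v` and `w`, so the edge contains both; edges
    -- contain no vertices but their ends, so it is `vw` itself.
    have main : ∀ y y', T.Adj y y' → s(y, y') ≠ s(v, w) → q ∈ segment ℝ (z y) (z y') →
        D ≤ A (z y) + B (z y) → D ≤ A (z y') + B (z y') → B (z y) ≤ B (z y') → False := by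
      intro y y' hy hne hq2 hy1 hy2 hle
      obtain ⟨η, h0', h1', hq'⟩ := (mem_segment_iff_exists_add _ _ _).1 hq2
      obtain ⟨f1, f2⟩ := hval η (z y) (z y')
      rw [← hq'] at f1 f2
      have hη0 : 0 < η := by
        refine h0'.lt_of_ne ?_
        rintro rfl
        exact hno ⟨y, by rw [hq']; push_cast; ring⟩
      have hη1 : η < 1 := by
        refine h1'.lt_of_ne ?_
        rintro rfl
        exact hno ⟨y', by rw [hq']; push_cast; ring⟩
      have hη1' := sub_pos.2 hη1
      have g1 : A (z y) + B (z y) = D := by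
        refine le_antisymm ?_ hy1
        by_contra! hc
        nlinarith [mul_pos hη1' (sub_pos.2 hc), mul_nonneg hη0.le (sub_nonneg.2 hy2)]
      have g2 : A (z y') + B (z y') = D := by
        refine le_antisymm ?_ hy2
        by_contra! hc
        nlinarith [mul_pos hη0 (sub_pos.2 hc), mul_nonneg hη1'.le (sub_nonneg.2 hy1)]
      have hinside : ∀ t, A (z t) + B (z t) = D → 0 ≤ A (z t) → 0 ≤ B (z t) → t = v ∨ t = w := by
        intro t h1 h2 h3
        rcases hemp t h2 h3 h1.le with rfl | h
        · simp only [hAdef, hBdef, sub_self, planeDet_zero_left, planeDet_zero_right] at h1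
          linarith
        · exact h
      have hBq2 : B q < D := by linarith
      have hlt : B (z y) < B (z y') := by
        refine hle.lt_of_ne fun heq => ?_
        have hBy : B (z y) = B q := by rw [f2, ← heq]; ring
        exact hno ⟨y, hcoord _ _ (by linarith) hBy.symm⟩
      have hqy : B (z y) < B q := by nlinarith
      have hqy' : B q < B (z y') := by nlinarith
      have hBy : B (z y) ≤ 0 := by
        by_contra! hc
        rcases hinside y g1 (by linarith) hc.le with rfl | rfl
        · linarith
        · linarith
      have hBy' : D ≤ B (z y') := by
        by_contra! hc
        rcases hinside y' g2 (by linarith) (by linarith) with rfl | rfl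
        · linarith
        · linarith
      have hmem : ∀ t, A (z t) + B (z t) = D → B (z y) ≤ B (z t) → B (z t) ≤ B (z y') →
          t = y ∨ t = y' := by
        intro t ht h1 h2
        refine hT.prop.vertex y y' t hy ((mem_segment_iff_exists_add _ _ _).2
          ⟨(B (z t) - B (z y)) / (B (z y') - B (z y)), div_nonneg (by linarith) (by linarith), ?_, ?_⟩)
        · rw [div_le_one (by linarith)]; linarith
        · have hne' : B (z y') - B (z y) ≠ 0 := by linarith
          obtain ⟨k1, k2⟩ := hval ((B (z t) - B (z y)) / (B (z y') - B (z y))) (z y) (z y')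
          have k3 : A (z y) = D - B (z y) := by linarith
          have k4 : A (z y') = D - B (z y') := by linarith
          refine hcoord _ _ ?_ ?_
          · rw [k1, k3, k4, show A (z t) = D - B (z t) by linarith]
            field_simp; ring
          · rw [k2]
            field_simp; ring
      have hv := hmem v (by linarith) (by linarith) (by linarith)
      have hw := hmem w (by linarith) (by linarith) (by linarith)
      apply hne
      rcases hv with rfl | rfl <;> rcases hw with rfl | rfl
      · exact absurd rfl hvw
      · rfl
      · exact Sym2.eq_swap
      · exact absurd rfl hvw
    rcases le_total (B (z y)) (B (z y')) with h | h
    · exact main y y' hy hne hq2 hy1 hy2 h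
    · exact main y' y hy.symm (by rwa [Sym2.eq_swap]) (by rwa [segment_symm]) hy2 hy1 h

end IsPlaneDrawing

/-! ### Rotation of darts about their vertices and the triangles of the face permutation. -/

/-- The direction of a dart. -/
def dartDir {V : Type*} {T : SimpleGraph V} (z : V → ℂ) (d : T.Dart) : ℂ := z d.snd - z d.fst

lemma norm_mul_sin_ccwAngle_sub (a b c : ℂ) :
    ‖b‖ * ‖c‖ * Real.sin (ccwAngle a c - ccwAngle a b) = planeDet b c := by
  rw [← norm_mul_sin_ccwAngle]
  obtain ⟨n1, e1⟩ := exists_ccwAngle_eq a b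
  obtain ⟨n2, e2⟩ := exists_ccwAngle_eq a c
  obtain ⟨n3, e3⟩ := exists_ccwAngle_eq b c
  have : ccwAngle a c - ccwAngle a b = ccwAngle b c + ((n2 - n1 - n3 : ℤ) : ℝ) * (2 * Real.pi) := by
    rw [e1, e2, e3]; push_cast; ring
  rw [this, Real.sin_add_int_mul_two_pi]

/-- The counterclockwise successor of darts around their initial vertices. -/
structure IsRotation {V : Type*} {T : SimpleGraph V} [Fintype V] [Fintype T.Dart] [DecidableEq V]
    (z : V → ℂ) (N : Equiv.Perm T.Dart) : Prop where
  fst : ∀ d, (N d).fst = d.fst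
  le : ∀ d d' : T.Dart, d'.fst = d.fst →
    ccwAngle (dartDir z d) (dartDir z (N d)) ≤ ccwAngle (dartDir z d) (dartDir z d')
  sum : ∀ d₀ : T.Dart, ∑ d with d.fst = d₀.fst, ccwAngle (dartDir z d) (dartDir z (N d)) =
    2 * Real.pi
  induct : ∀ (P : T.Dart → Prop) (d₀ : T.Dart), P d₀ → (∀ d, P d → P (N d)) →
    ∀ d : T.Dart, d.fst = d₀.fst → P d

namespace IsPlaneDrawing

variable {V : Type*} {z : V → ℂ} {T : SimpleGraph V} {u v w : V}

/-- Of two edges in the same direction from `u`, the longer one would pass through the end of the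
shorter. -/
lemma eq_of_arg_eq (hT : IsPlaneDrawing z T) (huv : T.Adj u v) (huw : T.Adj u w)
    (h : Complex.arg (z v - z u) = Complex.arg (z w - z u)) : v = w := by
  have hv : z v - z u ≠ 0 := sub_ne_zero.2 fun h => huv.ne (hT.injective h).symm
  have hw : z w - z u ≠ 0 := sub_ne_zero.2 fun h => huw.ne (hT.injective h).symm
  have hnv := norm_pos_iff.2 hv
  have hnw := norm_pos_iff.2 hw
  have key : ∀ {v w}, T.Adj u v → T.Adj u w → z v - z u ≠ 0 →
      Complex.arg (z v - z u) = Complex.arg (z w - z u) → ‖z w - z u‖ ≤ ‖z v - z u‖ → v = w := by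
    intro v w huv huw hv h hle
    have hw : z w - z u ≠ 0 := sub_ne_zero.2 fun h => huw.ne (hT.injective h).symm
    have h1 := (Complex.arg_eq_arg_iff hv hw).1 h
    have hnv := norm_pos_iff.2 hv
    rcases hT.vertex u v w huv ((mem_segment_iff_exists_add _ _ _).2
      ⟨‖z w - z u‖ / ‖z v - z u‖, by positivity, by rwa [div_le_one hnv], by
        push_cast; rw [h1]; ring⟩) with h | h
    · exact absurd h.symm huw.ne
    · exact h.symm
  rcases le_total ‖z w - z u‖ ‖z v - z u‖ with hle | hle
  · exact key huv huw hv h hle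
  · exact (key huw huv hw h.symm hle).symm

lemma dartDir_ne_zero (hT : IsPlaneDrawing z T) (d : T.Dart) : dartDir z d ≠ 0 :=
  sub_ne_zero.2 fun h => d.adj.ne (hT.injective h).symm

lemma dart_eq_of_arg_eq (hT : IsPlaneDrawing z T) {d d' : T.Dart} (hd : d.fst = d'.fst)
    (h : Complex.arg (dartDir z d) = Complex.arg (dartDir z d')) : d = d' := by
  have h2 : d.snd = d'.snd := by
    refine hT.eq_of_arg_eq d.adj (by rw [hd]; exact d'.adj) ?_
    unfold dartDir at h
    rw [h, hd]
  exact SimpleGraph.Dart.ext _ _ (Prod.ext hd h2)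

lemma exists_isRotation [Fintype V] [Fintype T.Dart] [DecidableEq V] (hT : IsPlaneDrawing z T) :
    ∃ N : Equiv.Perm T.Dart, IsRotation z N := by
  have hex : ∀ u : V, ∃ σ : Equiv.Perm {d : T.Dart // d.fst = u},
      (∀ i j : {d : T.Dart // d.fst = u}, ccwAngle (dartDir z i.1) (dartDir z (σ i).1) ≤
        ccwAngle (dartDir z i.1) (dartDir z j.1)) ∧
      (Nonempty {d : T.Dart // d.fst = u} →
        ∑ i, ccwAngle (dartDir z i.1) (dartDir z (σ i).1) = 2 * Real.pi) ∧
      ∀ (P : {d : T.Dart // d.fst = u} → Prop) (i₀ : {d : T.Dart // d.fst = u}), P i₀ →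
        (∀ i, P i → P (σ i)) → ∀ i, P i := by
    intro u
    by_cases hne : Nonempty {d : T.Dart // d.fst = u}
    · obtain ⟨σ, h1, h2, h3⟩ := exists_ccw_perm
        (fun i : {d : T.Dart // d.fst = u} => dartDir z i.1)
        (fun (i j : {d : T.Dart // d.fst = u}) h => Subtype.ext (hT.dart_eq_of_arg_eq (i.2.trans j.2.symm) h))
      exact ⟨σ, h1, fun _ => h2, h3⟩
    · refine ⟨1, fun i => absurd ⟨i⟩ hne, fun h => absurd h hne, fun _ i => absurd ⟨i⟩ hne⟩
  choose σ h1 h2 h3 using hex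
  let e := Equiv.sigmaFiberEquiv (fun d : T.Dart => d.fst)
  obtain ⟨N, hN⟩ : ∃ N : Equiv.Perm T.Dart, ∀ u (i : {d : T.Dart // d.fst = u}),
      N i.1 = (σ u i).1 := by
    refine ⟨(e.symm.trans (Equiv.sigmaCongrRight σ)).trans e, ?_⟩
    rintro u ⟨d, rfl⟩
    rfl
  have hN' : ∀ d, N d = (σ d.fst ⟨d, rfl⟩).1 := fun d => hN _ ⟨d, rfl⟩
  refine ⟨N, ⟨?_, ?_, ?_, ?_⟩⟩
  · intro d
    rw [hN']
    exact (σ d.fst ⟨d, rfl⟩).2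
  · intro d d' h
    rw [hN']
    exact h1 d.fst ⟨d, rfl⟩ ⟨d', h⟩
  · intro d₀
    rw [← h2 d₀.fst ⟨⟨d₀, rfl⟩⟩, Finset.sum_subtype (p := fun d => d.fst = d₀.fst) _ (by simp)]
    exact Finset.sum_congr rfl fun i _ => by rw [hN]
  · intro P d₀ h0 hP d hd
    refine h3 d₀.fst (fun i => P i.1) ⟨d₀, rfl⟩ h0 ?_ ⟨d, hd⟩
    intro i hi
    have := hP _ hi
    rwa [hN] at this

end IsPlaneDrawing

namespace IsRotation

variable {V : Type*} {z : V → ℂ} {T : SimpleGraph V} [Fintype V] [Fintype T.Dart] [DecidableEq V]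
  {N : Equiv.Perm T.Dart}

/-- Consecutive darts at an angle less than `π` span a triangle: the face permutation
`d ↦ N.symm d.symm` leads from its first side to the second. -/
lemma exists_triangle (hT : Maximal (IsPlaneDrawing z) T) (hN : IsRotation z N) (d : T.Dart)
    (hd : 0 < planeDet (dartDir z d) (dartDir z (N d))) :
    (N.symm d.symm).fst = d.snd ∧ (N.symm d.symm).snd = (N d).snd ∧
      planeDet (dartDir z (N.symm d.symm)) (dartDir z d.symm) =
        planeDet (dartDir z d) (dartDir z (N d)) := by
  set u := d.fst with hu
  set v := d.snd with hv
  set w := (N d).snd with hw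
  have hNu : (N d).fst = u := hN.fst d
  have huv : T.Adj u v := d.adj
  have huw : T.Adj u w := by rw [← hNu]; exact (N d).adj
  have hdir : dartDir z (N d) = z w - z u := by rw [dartDir, hNu]
  have hdir' : dartDir z d = z v - z u := rfl
  rw [hdir, hdir'] at hd
  have hcone : ∀ x, T.Adj u x →
      ¬(0 < planeDet (z x - z u) (z w - z u) ∧ 0 < planeDet (z v - z u) (z x - z u)) := by
    rintro x hx ⟨hA, hB⟩
    have := ccwAngle_lt_of_planeDet_pos hB hA hd
    have h2 := hN.le d ⟨(u, x), hx⟩ rfl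
    rw [hdir, hdir'] at h2
    exact absurd this (not_lt.2 h2)
  have hvw := IsPlaneDrawing.adj_of_consecutive hT huv huw hd hcone
  have hemp := IsPlaneDrawing.eq_of_mem_triangle hT huv huw hd hcone
  set D := planeDet (z v - z u) (z w - z u) with hD
  let d₁ : T.Dart := ⟨(v, w), hvw⟩
  have hdir₁ : dartDir z d₁ = z w - z v := rfl
  have hdirs : dartDir z d.symm = z u - z v := rfl
  have hD1 : planeDet (z w - z v) (z u - z v) = D := by
    simp only [hD, planeDet_apply, Complex.sub_re, Complex.sub_im]; ring
  have hN1 : N d₁ = d.symm := by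
    have hle := hN.le d₁ d.symm rfl
    rcases hle.eq_or_lt with heq | hlt
    · exact hT.prop.dart_eq_of_arg_eq (hN.fst d₁) (arg_eq_of_ccwAngle_eq heq)
    -- An edge `vx` strictly between `vw` and `vu` either ends in the triangle, which is empty, or
    -- has `A < 0` and then crosses `uw`.
    · exfalso
      have hx1 := (N d₁).adj
      rw [hN.fst d₁] at hx1
      have hdirx : dartDir z (N d₁) = z (N d₁).snd - z v := by rw [dartDir, hN.fst d₁]
      generalize (N d₁).snd = x at hx1 hdirx
      change T.Adj v x at hx1
      rw [hdirx, hdir₁, hdirs] at hlt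
      have hw0 : z w - z v ≠ 0 := sub_ne_zero.2 fun h => hvw.ne (hT.prop.injective h).symm
      have hu0 : z u - z v ≠ 0 := sub_ne_zero.2 fun h => huv.ne (hT.prop.injective h)
      have hx0 : z x - z v ≠ 0 := sub_ne_zero.2 fun h => hx1.ne (hT.prop.injective h).symm
      have hpi := (ccwAngle_lt_pi_iff hw0 hu0).2 (by rw [hD1]; exact hd)
      have hB' : 0 < planeDet (z w - z v) (z x - z v) :=
        (ccwAngle_lt_pi_iff hw0 hx0).1 (hlt.trans hpi)
      have hA' : 0 < planeDet (z x - z v) (z u - z v) := by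
        rw [← norm_mul_sin_ccwAngle_sub (z w - z v)]
        have := ccwAngle_pos (a := z w - z v) (b := z x - z v)
        have := Real.sin_pos_of_pos_of_lt_pi (sub_pos.2 hlt) (by linarith)
        positivity
      set A := planeDet (z x - z u) (z w - z u) with hA
      set B := planeDet (z v - z u) (z x - z u) with hB
      have eA : planeDet (z x - z v) (z u - z v) = B := by
        simp only [hB, planeDet_apply, Complex.sub_re, Complex.sub_im]; ring
      have eB : planeDet (z w - z v) (z x - z v) = D - A - B := by
        simp only [hD, hA, hB, planeDet_apply, Complex.sub_re, Complex.sub_im]; ring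
      rw [eA] at hA'
      rw [eB] at hB'
      rcases le_or_gt 0 A with h | h
      · rcases hemp x h hA'.le (by linarith) with rfl | rfl | rfl
        · rw [hB, sub_self, planeDet_zero_right] at hA'
          exact lt_irrefl _ hA'
        · exact hx1.ne rfl
        · linarith
      · have hDA : 0 < D - A := by linarith
        -- The parameter on `vx` at which the coordinate falling from `D` at `v` to `A` at `x`
        -- vanishes, that is, where the edge meets the line `uw`.
        set s := D / (D - A) with hs
        have hs0 : 0 < s := by positivity
        have hs1 : s < 1 := by rw [hs, div_lt_one hDA]; linarith
        set p := z v + s * (z x - z v) with hp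
        have hpu : p - z u = (z v - z u) + s * ((z x - z u) - (z v - z u)) := by rw [hp]; ring
        have hpA : planeDet (p - z u) (z w - z u) = 0 := by
          rw [hpu, planeDet_lineMap_left]
          change (1 - s) * D + s * A = 0
          rw [hs]; field_simp; ring
        have hpB : planeDet (z v - z u) (p - z u) = s * B := by
          rw [hpu, planeDet_lineMap_right, planeDet_self, mul_zero, zero_add]
        have hsB : s * B < D := by
          rw [hs, div_mul_eq_mul_div, div_lt_iff₀ hDA]
          nlinarith
        have hpw := eq_add_of_planeDet_eq_zero hd.ne' hpA
        rw [hpB] at hpw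
        have hpseg : p ∈ segment ℝ (z u) (z w) :=
          (mem_segment_iff_exists_add _ _ _).2 ⟨s * B / D, by positivity,
            by rw [div_le_one hd]; exact hsB.le, by rw [← hpw]; ring⟩
        have hpseg' : p ∈ segment ℝ (z v) (z x) :=
          (mem_segment_iff_exists_add _ _ _).2 ⟨s, hs0.le, hs1.le, hp⟩
        have hne : s(v, x) ≠ s(u, w) := by
          intro h
          have : v ∈ s(u, w) := by rw [← h]; simp
          rcases Sym2.mem_iff.1 this with h | h
          · exact huv.ne h.symm
          · exact hvw.ne h
        obtain ⟨t, ht⟩ := hT.prop.edge _ _ _ _ hx1 huw hne p hpseg' hpseg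
        rw [ht] at hpB
        rcases hT.prop.vertex u w t huw (ht ▸ hpseg) with h | h
        · rw [h, sub_self, planeDet_zero_right] at hpB
          have : 0 < s * B := by positivity
          linarith
        · have : planeDet (z v - z u) (z t - z u) = D := by rw [h]
          linarith
  have hsymm : N.symm d.symm = d₁ := by rw [← hN1, Equiv.symm_apply_apply]
  rw [hsymm]
  refine ⟨rfl, rfl, ?_⟩
  rw [hdir₁, hdirs, hdir, hdir']
  exact hD1

end IsRotation

/-! ### Gluing triangles into faces, with a spanning-tree count. -/

/-- The dual graph in which two nodes are joined when a dart of `R` leads from one to the other. -/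
def dualGraph {B N : Type*} (σ : B → B) (hσ : ∀ d, σ (σ d) = d) (R : B → Prop)
    (hR : ∀ d, R d → R (σ d)) (node : B → N) : SimpleGraph N where
  Adj A A' := A ≠ A' ∧ ∃ d, R d ∧ node d = A ∧ node (σ d) = A'
  symm := ⟨fun A A' ⟨hne, d, hd, h1, h2⟩ => ⟨hne.symm, σ d, hR d hd, h2, by rw [hσ, h1]⟩⟩
  loopless := ⟨fun _ h => h.1 rfl⟩

/-- A connected graph has at most one more vertex than edges, and the two darts of each dual edge
come from distinct darts of `R`. Multiple dual edges and loops only help the inequality. -/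
lemma two_mul_card_supp_le {B N : Type*} [Fintype B] [Finite N] (σ : B → B)
    (hσ : ∀ d, σ (σ d) = d) (R : B → Prop) [DecidablePred R]
    (hR : ∀ d, R d → R (σ d)) (node : B → N)
    (C : (dualGraph σ hσ R hR node).ConnectedComponent)
    [DecidablePred fun d => (dualGraph σ hσ R hR node).connectedComponentMk (node d) = C] :
    2 * Nat.card C.supp ≤
      (Finset.univ.filter fun d => R d ∧
        (dualGraph σ hσ R hR node).connectedComponentMk (node d) = C).card + 2 := by
  classical
  have := Fintype.ofFinite N
  have h1 := C.connected_toSimpleGraph.card_vert_le_card_edgeSet_add_one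
  have h2 : 2 * Nat.card C.toSimpleGraph.edgeSet = Fintype.card C.toSimpleGraph.Dart := by
    rw [SimpleGraph.dart_card_eq_twice_card_edges, Nat.card_eq_fintype_card,
      SimpleGraph.edgeFinset_card]
  have hex : ∀ δ : C.toSimpleGraph.Dart, ∃ d, R d ∧ node d = δ.fst.1 ∧ node (σ d) = δ.snd.1 :=
    fun δ => δ.adj.2
  choose g hg1 hg2 hg3 using hex
  have h3 : Fintype.card C.toSimpleGraph.Dart ≤ (Finset.univ.filter fun d => R d ∧
        (dualGraph σ hσ R hR node).connectedComponentMk (node d) = C).card := by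
    rw [← Finset.card_univ]
    refine Finset.card_le_card_of_injOn g ?_ ?_
    · intro δ _
      simp only [Finset.coe_filter, Finset.mem_univ, true_and, Set.mem_ofPred_eq]
      exact ⟨hg1 δ, by rw [hg2 δ]; exact δ.fst.2⟩
    · intro δ _ δ' _ h
      refine SimpleGraph.Dart.ext _ _ (Prod.ext (Subtype.ext ?_) (Subtype.ext ?_))
      · rw [← hg2, ← hg2, h]
      · rw [← hg3, ← hg3, h]
  change Nat.card C.supp ≤ _ at h1
  omega

/-- A finite set of darts with an edge involution `σ`, some of which (`tri`) are grouped in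
triangles by `φ`. -/
structure IsTriangleMap {B : Type*} (σ φ : B → B) (tri : B → Prop) : Prop where
  invol : ∀ d, σ (σ d) = d
  ne_self : ∀ d, σ d ≠ d
  tri_next : ∀ d, tri d → tri (φ d)
  next_three : ∀ d, tri d → φ (φ (φ d)) = d
  next_ne : ∀ d, tri d → φ d ≠ d

/-- The merging of triangles across the darts of `R`: `comp` assigns to a dart its merged face,
all darts outside triangles belong to the face `O`, and `t` counts triangles. -/
structure IsMerging {B C : Type*} [Fintype B] [DecidableEq C] (σ φ : B → B) (tri R : B → Prop)
    [DecidablePred tri] [DecidablePred R] (comp : B → C) (O : C) (t : C → ℕ) : Prop where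
  comp_symm : ∀ d, R d → comp (σ d) = comp d
  comp_next : ∀ d, tri d → comp (φ d) = comp d
  comp_outer : ∀ d, ¬tri d → comp d = O
  card_tri : ∀ c, (Finset.univ.filter fun d => tri d ∧ comp d = c).card = 3 * t c
  inner : ∀ c, c ≠ O → 2 * t c ≤ (Finset.univ.filter fun d => R d ∧ comp d = c).card + 2
  outer : 2 * t O ≤ (Finset.univ.filter fun d => R d ∧ comp d = O).card
  exists_symm : ∀ c, c ≠ O → 2 ≤ t c →
    ∃ d, R d ∧ comp d = c ∧ σ d ≠ d ∧ σ d ≠ φ d ∧ σ d ≠ φ (φ d)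

namespace IsTriangleMap

universe u

variable {B : Type u} {σ φ : B → B} {tri : B → Prop}

/-- Two triangle darts are related if they belong to the same triangle. -/
def triSetoid (h : IsTriangleMap σ φ tri) : Setoid {d // tri d} where
  r d d' := d'.1 = d.1 ∨ d'.1 = φ d.1 ∨ d'.1 = φ (φ d.1)
  iseqv := by
    refine ⟨fun d => Or.inl rfl, ?_, ?_⟩
    · rintro ⟨d, hd⟩ ⟨d', hd'⟩ h1
      have h3 := h.next_three d hd
      simp only at h1 ⊢
      rcases h1 with rfl | rfl | rfl
      · simp
      · simp [h3]
      · simp [h3]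
    · rintro ⟨d, hd⟩ ⟨d', hd'⟩ ⟨d'', hd''⟩ h1 h2
      have h3 := h.next_three d hd
      simp only at h1 h2 ⊢
      rcases h1 with rfl | rfl | rfl <;> rcases h2 with rfl | rfl | rfl <;> simp [h3]

open Classical in
lemma exists_merging [Fintype B] (h : IsTriangleMap σ φ tri) (R : B → Prop)
    (hR : ∀ d, R d → R (σ d)) :
    ∃ (C : Type u) (_ : Fintype C) (comp : B → C) (O : C) (t : C → ℕ),
      IsMerging σ φ tri R comp O t := by
  let Q := Quotient h.triSetoid
  -- The nodes are the triangles and one extra node `none` for all darts outside triangles. The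
  -- extra node is counted in the component `O` alone, which makes the bound `outer` stronger by 2
  -- than `inner`.
  let node : B → Option Q := fun d => if hd : tri d then some (Quotient.mk _ ⟨d, hd⟩) else none
  have node_tri : ∀ d (hd : tri d), node d = some (Quotient.mk _ ⟨d, hd⟩) := fun d hd => dif_pos hd
  have node_none : ∀ d, ¬tri d → node d = none := fun d hd => dif_neg hd
  have tri_of_node : ∀ d q, node d = some q → tri d := by
    intro d q hd
    by_contra hn
    rw [node_none d hn] at hd
    exact absurd hd (by simp)
  have node_eq : ∀ d d', tri d → (node d' = node d ↔ d' = d ∨ d' = φ d ∨ d' = φ (φ d)) := by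
    intro d d' hd
    constructor
    · intro hdd
      rw [node_tri d hd] at hdd
      have hd' := tri_of_node d' _ hdd
      rw [node_tri d' hd', Option.some_inj] at hdd
      have hex := Quotient.exact hdd
      exact Setoid.symm' h.triSetoid hex
    · intro hdd
      have hd' : tri d' := by
        rcases hdd with rfl | rfl | rfl
        exacts [hd, h.tri_next _ hd, h.tri_next _ (h.tri_next _ hd)]
      rw [node_tri d hd, node_tri d' hd']
      exact congrArg some (Quotient.sound (Setoid.symm' h.triSetoid hdd))
  let Γ := dualGraph σ h.invol R hR node
  let comp : B → Γ.ConnectedComponent := fun d => Γ.connectedComponentMk (node d)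
  let O : Γ.ConnectedComponent := Γ.connectedComponentMk none
  let t : Γ.ConnectedComponent → ℕ := fun c =>
    (Finset.univ.filter fun q : Q => Γ.connectedComponentMk (some q) = c).card
  have hsupp : ∀ c : Γ.ConnectedComponent, Nat.card c.supp = t c + if c = O then 1 else 0 := by
    intro c
    have : c.supp = ((Finset.univ.filter fun A => Γ.connectedComponentMk A = c : Finset (Option Q)) :
        Set (Option Q)) := by
      ext A
      simp
    rw [this, Nat.card_coe_set_eq, Set.ncard_coe_finset, Finset.card_filter,
      Fintype.sum_option, ← Finset.card_filter, add_comm]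
    congr 1
    exact if_congr eq_comm rfl rfl
  refine ⟨Γ.ConnectedComponent, inferInstance, comp, O, t, ?_, ?_, ?_, ?_, ?_, ?_, ?_⟩
  · intro d hd
    by_cases hne : node d = node (σ d)
    · exact congrArg Γ.connectedComponentMk hne.symm
    · refine SimpleGraph.ConnectedComponent.sound (SimpleGraph.Adj.reachable ?_)
      exact ⟨Ne.symm hne, σ d, hR d hd, rfl, by rw [h.invol]⟩
  · intro d hd
    exact congrArg Γ.connectedComponentMk ((node_eq d _ hd).2 (Or.inr (Or.inl rfl)))
  · intro d hd
    exact congrArg Γ.connectedComponentMk (node_none d hd)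
  · intro c
    have hmap : ∀ d ∈ (Finset.univ.filter fun d => tri d ∧ comp d = c),
        node d ∈ (Finset.univ.filter fun q : Q => Γ.connectedComponentMk (some q) = c).image some := by
      intro d hd
      simp only [Finset.mem_filter, Finset.mem_univ, true_and, Finset.mem_image] at hd ⊢
      refine ⟨_, ?_, (node_tri d hd.1).symm⟩
      rw [← node_tri d hd.1]
      exact hd.2
    rw [Finset.card_eq_sum_card_fiberwise hmap, Finset.sum_image (by simp)]
    rw [Finset.sum_const_nat (m := 3), mul_comm]
    intro q hq
    simp only [Finset.mem_filter, Finset.mem_univ, true_and] at hq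
    obtain ⟨⟨d, hd⟩, rfl⟩ := Quotient.exists_rep q
    have hset : ({d' ∈ Finset.univ.filter fun d => tri d ∧ comp d = c |
        node d' = some (Quotient.mk h.triSetoid ⟨d, hd⟩)} : Finset B) = {d, φ d, φ (φ d)} := by
      ext d'
      rw [← node_tri d hd] at hq ⊢
      simp only [Finset.mem_filter, Finset.mem_univ, true_and, Finset.mem_insert,
        Finset.mem_singleton]
      rw [node_eq d d' hd]
      constructor
      · exact fun h => h.2
      · intro hdd
        refine ⟨⟨?_, ?_⟩, hdd⟩
        · rcases hdd with rfl | rfl | rfl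
          exacts [hd, h.tri_next _ hd, h.tri_next _ (h.tri_next _ hd)]
        · rw [← hq]
          exact congrArg Γ.connectedComponentMk ((node_eq d d' hd).2 hdd)
    rw [hset]
    have n1 := h.next_ne d hd
    have n2 := h.next_ne _ (h.tri_next d hd)
    have n3 := h.next_ne _ (h.tri_next _ (h.tri_next d hd))
    rw [h.next_three d hd] at n3
    rw [Finset.card_insert_of_notMem, Finset.card_insert_of_notMem, Finset.card_singleton]
    · simpa using n2.symm
    · simpa using ⟨n1.symm, n3⟩
  · intro c hc
    have h1 := two_mul_card_supp_le σ h.invol R hR node c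
    rw [hsupp c, if_neg hc] at h1
    exact h1
  · have h1 := two_mul_card_supp_le σ h.invol R hR node O
    rw [hsupp O, if_pos rfl] at h1
    have : 2 * t O + 2 ≤ (Finset.univ.filter fun d => R d ∧ comp d = O).card + 2 := h1
    omega
  · intro c hc h2
    obtain ⟨q, hq, q', hq', hne⟩ := Finset.one_lt_card.1 (show 1 < t c from h2)
    simp only [Finset.mem_filter, Finset.mem_univ, true_and] at hq hq'
    obtain ⟨p⟩ := SimpleGraph.ConnectedComponent.exact (hq.trans hq'.symm)
    -- A component with two triangles contains a path between them; the first step of the path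
    -- crosses a dart of `R` that leads out of its triangle.
    cases p with
    | nil => exact absurd rfl hne
    | cons hadj p =>
      obtain ⟨hne', d, hRd, h1, h2⟩ := hadj
      have hd := tri_of_node d q h1
      refine ⟨d, hRd, ?_, ?_⟩
      · change Γ.connectedComponentMk (node d) = c
        rw [h1, hq]
      · have := mt (node_eq d (σ d) hd).2 (by rw [h1, h2]; exact hne'.symm)
        push Not at this
        exact this

end IsTriangleMap

/-! ### The charge of an angle. -/

/-- Twice the part of `(y - 1) / 2` outside `[0, 1/2]`. -/
noncomputable def excess (y : ℝ) : ℝ := min (y - 1) 0 + max (y - 2) 0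

lemma sub_two_le_excess (y : ℝ) : y - 2 ≤ excess y := by
  unfold excess
  rcases le_total (y - 1) 0 with h | h <;> rcases le_total (y - 2) 0 with h' | h' <;>
    simp only [min_eq_left, min_eq_right, max_eq_left, max_eq_right, h, h'] <;> linarith

lemma excess_le_sub_one (y : ℝ) : excess y ≤ y - 1 := by
  unfold excess
  rcases le_total (y - 1) 0 with h | h <;> rcases le_total (y - 2) 0 with h' | h' <;>
    simp only [min_eq_left, min_eq_right, max_eq_left, max_eq_right, h, h'] <;> linarith

lemma excess_nonneg {y : ℝ} (hy : 1 ≤ y) : 0 ≤ excess y := by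
  unfold excess
  rw [min_eq_right (by linarith), zero_add]
  exact le_max_right _ _

lemma excess_nonpos {y : ℝ} (hy : y ≤ 2) : excess y ≤ 0 := by
  unfold excess
  rw [max_eq_right (by linarith), add_zero]
  exact min_le_right _ _

lemma excess_of_le_one {y : ℝ} (hy : y ≤ 1) : excess y = y - 1 := by
  unfold excess
  rw [min_eq_left (by linarith), max_eq_right (by linarith), add_zero]

lemma excess_of_two_le {y : ℝ} (hy : 2 ≤ y) : excess y = y - 2 := by
  unfold excess
  rw [min_eq_right (by linarith), max_eq_left (by linarith), zero_add]

lemma excess_mono {y y' : ℝ} (h : y ≤ y') : excess y ≤ excess y' := by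
  unfold excess
  gcongr

/-- The charge is odd about 3/2, so supplementary angles of a rhombus cancel. -/
lemma excess_add_excess_three_sub (y : ℝ) : excess y + excess (3 - y) = 0 := by
  rcases le_total y 1 with h | h
  · rw [excess_of_le_one h, excess_of_two_le (by linarith)]; ring
  · rcases le_total 2 y with h' | h'
    · rw [excess_of_two_le h', excess_of_le_one (by linarith)]; ring
    · refine le_antisymm ?_ ?_
      · have := excess_nonpos h'
        have := excess_nonpos (y := 3 - y) (by linarith)
        linarith
      · have := excess_nonneg h
        have := excess_nonneg (y := 3 - y) (by linarith)
        linarith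

/-- With at least five angles, an angle above 2 has charge y - 2 and the others at most y - 1 each,
so the total is at most 5 minus the number of angles; without such an angle no charge is positive.
With two to four angles, y - 1 throughout suffices. -/
lemma sum_excess_le_of_sum_eq_six {ι : Type*} (s : Finset ι) (y : ι → ℝ)
    (hy : ∑ i ∈ s, y i = 6) : ∑ i ∈ s, excess (y i) ≤ if s.card ≤ 4 then 4 else 0 := by
  have h1 : ∑ i ∈ s, excess (y i) ≤ 6 - s.card := by
    calc ∑ i ∈ s, excess (y i) ≤ ∑ i ∈ s, (y i - 1) :=
          Finset.sum_le_sum fun i _ => excess_le_sub_one _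
      _ = 6 - s.card := by rw [Finset.sum_sub_distrib, hy]; simp
  split_ifs with hs
  · rcases Nat.lt_or_ge s.card 2 with h2 | h2
    · rcases Nat.lt_or_ge s.card 1 with h0 | h0
      · have : s = ∅ := Finset.card_eq_zero.1 (by omega)
        simp [this]
      · obtain ⟨i, rfl⟩ := Finset.card_eq_one.1 (show s.card = 1 by omega)
        rw [Finset.sum_singleton] at hy ⊢
        rw [hy, excess_of_two_le (by norm_num)]
        norm_num
    · have : (2 : ℝ) ≤ s.card := by exact_mod_cast h2
      linarith
  · by_cases h : ∃ i ∈ s, 2 < y i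
    · obtain ⟨i, hi, h2⟩ := h
      have h3 : (5 : ℝ) ≤ s.card := by exact_mod_cast (by omega : 5 ≤ s.card)
      classical
      rw [← Finset.add_sum_erase s _ hi] at hy ⊢
      rw [excess_of_two_le h2.le]
      have h4 : ∑ i ∈ s.erase i, excess (y i) ≤ ∑ i ∈ s.erase i, (y i - 1) :=
        Finset.sum_le_sum fun i _ => excess_le_sub_one _
      rw [Finset.sum_sub_distrib, Finset.sum_const, nsmul_eq_mul, mul_one,
        Finset.cast_card_erase_of_mem hi] at h4
      linarith
    · push Not at h
      exact Finset.sum_nonpos fun i hi => excess_nonpos (h i hi)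

/-- If some angle is below 1, its charge is y - 1 and the other four have at least y - 2, for a
total of 9 - 1 - 8 = 0. No shape beyond the angle sum of a pentagon is needed. -/
lemma sum_excess_five {ι : Type*} (s : Finset ι) (y : ι → ℝ) (hs : s.card = 5)
    (hy : ∑ i ∈ s, y i = 9) : 0 ≤ ∑ i ∈ s, excess (y i) := by
  by_cases h : ∃ i ∈ s, y i < 1
  · obtain ⟨i, hi, h2⟩ := h
    classical
    rw [← Finset.add_sum_erase s _ hi] at hy ⊢
    rw [excess_of_le_one h2.le]
    have h4 : ∑ i ∈ s.erase i, (y i - 2) ≤ ∑ i ∈ s.erase i, excess (y i) :=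
      Finset.sum_le_sum fun i _ => sub_two_le_excess _
    rw [Finset.sum_sub_distrib, Finset.sum_const, nsmul_eq_mul,
      Finset.cast_card_erase_of_mem hi, hs] at h4
    push_cast at h4
    linarith
  · push Not at h
    exact Finset.sum_nonneg fun i hi => excess_nonneg (h i hi)

/-! ### Discharging and counting on the faces. -/

/-- Angles `x d`, in units of `π / 3`, from a dart to the next dart around its vertex, in a
triangulation containing the unit edges `G`. -/
structure IsAngleMap {B V : Type*} [Fintype B] [DecidableEq V] (σ φ : B → B) (tri G : B → Prop)
    (src : B → V) (x : B → ℝ) : Prop where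
  symm_iff : ∀ d, G (σ d) ↔ G d
  src_next : ∀ d, tri d → src (φ d) = src (σ d)
  src_ne : ∀ d, src (σ d) ≠ src d
  nonneg : ∀ d, 0 ≤ x d
  sum_tri : ∀ d, tri d → x d + x (φ d) + x (φ (φ d)) = 3
  outer : ∀ d, ¬tri d → 3 ≤ x d
  sum_src : ∀ v, ∑ d with src d = v, x d = 6
  isosceles : ∀ d, tri d → G (φ d) → G (φ (φ d)) → x d = x (φ d)
  rhombus : ∀ d, tri d → G (φ d) → G (φ (φ d)) → tri (σ d) → G (φ (σ d)) → G (φ (φ (σ d))) →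
    x d = x (σ d)

section merging

variable {B C : Type*} [Fintype B] [DecidableEq C] {σ φ : B → B} {tri G : B → Prop}
  [DecidablePred tri] [DecidablePred G] {comp : B → C} {O : C} {t : C → ℕ}

/-- `φ` permutes the triangle darts of a face, so a sum over them may be averaged over the three
darts of each triangle. -/
lemma IsTriangleMap.sum_tri_eq (hT : IsTriangleMap σ φ tri)
    (hM : IsMerging σ φ tri (fun d => ¬G d) comp O t) (a : B → ℝ) (c : C) :
    ∑ d with tri d ∧ comp d = c, a d =
      1 / 3 * ∑ d with tri d ∧ comp d = c, (a d + a (φ d) + a (φ (φ d))) := by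
  have key : ∀ a : B → ℝ, ∑ d with tri d ∧ comp d = c, a (φ d) =
      ∑ d with tri d ∧ comp d = c, a d := by
    intro a
    refine Finset.sum_nbij' φ (fun d => φ (φ d)) ?_ ?_ ?_ ?_ ?_
    · intro d hd
      simp only [Finset.mem_filter, Finset.mem_univ, true_and] at hd ⊢
      exact ⟨hT.tri_next d hd.1, (hM.comp_next d hd.1).trans hd.2⟩
    · intro d hd
      simp only [Finset.mem_filter, Finset.mem_univ, true_and] at hd ⊢
      have h1 := hT.tri_next d hd.1
      exact ⟨hT.tri_next _ h1, (hM.comp_next _ h1).trans ((hM.comp_next d hd.1).trans hd.2)⟩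
    · intro d hd
      simp only [Finset.mem_filter, Finset.mem_univ, true_and] at hd
      exact hT.next_three d hd.1
    · intro d hd
      simp only [Finset.mem_filter, Finset.mem_univ, true_and] at hd
      exact hT.next_three d hd.1
    · intro d _
      rfl
  rw [Finset.sum_add_distrib, Finset.sum_add_distrib, key (fun d => a (φ d)), key a]
  ring

namespace IsMerging

lemma tri_of_comp_ne (hM : IsMerging σ φ tri (fun d => ¬G d) comp O t) {d : B} (h : comp d ≠ O) : tri d := by
  by_contra hd
  exact h (hM.comp_outer d hd)

lemma filter_comp_eq (hM : IsMerging σ φ tri (fun d => ¬G d) comp O t) {c : C} (hc : c ≠ O) :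
    (Finset.univ.filter fun d => comp d = c) = Finset.univ.filter fun d => tri d ∧ comp d = c := by
  ext d
  simp only [Finset.mem_filter, Finset.mem_univ, true_and, iff_and_self]
  rintro rfl
  exact hM.tri_of_comp_ne hc

end IsMerging

lemma sum_filter_comp_split (a : B → ℝ) (c : C) :
    ∑ d with comp d = c, a d = ∑ d with G d ∧ comp d = c, a d + ∑ d with ¬G d ∧ comp d = c, a d := by
  rw [← Finset.sum_filter_add_sum_filter_not (Finset.univ.filter fun d => comp d = c) G,
    Finset.filter_filter, Finset.filter_filter]
  simp only [and_comm]

lemma card_filter_comp_split (c : C) :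
    (Finset.univ.filter fun d => comp d = c).card =
      (Finset.univ.filter fun d => G d ∧ comp d = c).card +
      (Finset.univ.filter fun d => ¬G d ∧ comp d = c).card := by
  rw [← Finset.card_filter_add_card_filter_not (s := Finset.univ.filter fun d => comp d = c) G,
    Finset.filter_filter, Finset.filter_filter]
  simp only [and_comm]

end merging

/-- Every dart is assigned a `G`-dart at the same vertex and in the same merged face. -/
structure IsCornerMap {B C V : Type*} (G : B → Prop) (src : B → V) (comp : B → C) (ψ : B → B) :
    Prop where
  mem : ∀ d, G (ψ d)
  src_eq : ∀ d, src (ψ d) = src d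
  comp_eq : ∀ d, comp (ψ d) = comp d
  self : ∀ d, G d → ψ d = d

set_option linter.unusedSectionVars false

section corner

variable {B C V : Type*} [Fintype B] [DecidableEq B] [DecidableEq C]
  [DecidableEq V] {σ φ ψ : B → B} {tri G : B → Prop} [DecidablePred tri] [DecidablePred G]
  {src : B → V} {x : B → ℝ} {comp : B → C} {O : C} {t : C → ℕ}

/-- The angle of the corner of `G` at the dart `d`. -/
def cornerAngle (ψ : B → B) (x : B → ℝ) (d : B) : ℝ := ∑ d' with ψ d' = d, x d'

lemma IsCornerMap.sum_comp (hψ : IsCornerMap G src comp ψ) (c : C) :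
    ∑ d with G d ∧ comp d = c, cornerAngle ψ x d = ∑ d with comp d = c, x d := by
  rw [← Finset.sum_fiberwise_of_maps_to (s := Finset.univ.filter fun d => comp d = c)
    (t := Finset.univ.filter fun d => G d ∧ comp d = c) (g := ψ)]
  · refine Finset.sum_congr rfl fun d hd => ?_
    simp only [Finset.mem_filter, Finset.mem_univ, true_and] at hd
    unfold cornerAngle
    rw [Finset.filter_filter]
    refine Finset.sum_congr (Finset.filter_congr fun d' _ => ?_) fun _ _ => rfl
    simp only [iff_and_self]
    rintro rfl
    rw [← hψ.comp_eq]; exact hd.2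
  · intro d hd
    simp only [Finset.mem_filter, Finset.mem_univ, true_and] at hd ⊢
    exact ⟨hψ.mem d, (hψ.comp_eq d).trans hd⟩

lemma IsCornerMap.sum_src (hψ : IsCornerMap G src comp ψ) (v : V) :
    ∑ d with G d ∧ src d = v, cornerAngle ψ x d = ∑ d with src d = v, x d := by
  rw [← Finset.sum_fiberwise_of_maps_to (s := Finset.univ.filter fun d => src d = v)
    (t := Finset.univ.filter fun d => G d ∧ src d = v) (g := ψ)]
  · refine Finset.sum_congr rfl fun d hd => ?_
    simp only [Finset.mem_filter, Finset.mem_univ, true_and] at hd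
    unfold cornerAngle
    rw [Finset.filter_filter]
    refine Finset.sum_congr (Finset.filter_congr fun d' _ => ?_) fun _ _ => rfl
    simp only [iff_and_self]
    rintro rfl
    rw [← hψ.src_eq]; exact hd.2
  · intro d hd
    simp only [Finset.mem_filter, Finset.mem_univ, true_and] at hd ⊢
    exact ⟨hψ.mem d, (hψ.src_eq d).trans hd⟩

lemma le_cornerAngle (hx : ∀ d, 0 ≤ x d) (s : Finset B) {d : B} (hs : ∀ d' ∈ s, ψ d' = d) :
    ∑ d' ∈ s, x d' ≤ cornerAngle ψ x d :=
  Finset.sum_le_sum_of_subset_of_nonneg (fun d' hd' => by simpa using hs d' hd')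
    fun _ _ _ => hx _

lemma IsAngleMap.src_distinct (hT : IsTriangleMap σ φ tri) (hA : IsAngleMap σ φ tri G src x)
    {d : B} (hd : tri d) : src d ≠ src (φ d) ∧ src (φ d) ≠ src (φ (φ d)) ∧
      src d ≠ src (φ (φ d)) := by
  have h1 := hA.src_next d hd
  have h2 := hA.src_next _ (hT.tri_next d hd)
  have h3 := hA.src_next _ (hT.tri_next _ (hT.tri_next d hd))
  rw [hT.next_three d hd] at h3
  refine ⟨?_, ?_, ?_⟩
  · rw [h1]; exact (hA.src_ne d).symm
  · rw [h2]; exact (hA.src_ne _).symm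
  · rw [h3]; exact hA.src_ne _

lemma IsAngleMap.equilateral (hT : IsTriangleMap σ φ tri) (hA : IsAngleMap σ φ tri G src x)
    {d : B} (hd : tri d) (h0 : G d) (h1 : G (φ d)) (h2 : G (φ (φ d))) : x d = 1 := by
  have e1 := hA.isosceles d hd h1 h2
  have e2 := hA.isosceles _ (hT.tri_next d hd) h2 (by rwa [hT.next_three d hd])
  have e3 := hA.sum_tri d hd
  linarith

lemma IsMerging.card_inner (hM : IsMerging σ φ tri (fun d => ¬G d) comp O t) {c : C} (hc : c ≠ O) :
    3 * t c = (Finset.univ.filter fun d => G d ∧ comp d = c).card +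
      (Finset.univ.filter fun d => ¬G d ∧ comp d = c).card := by
  rw [← card_filter_comp_split, hM.filter_comp_eq hc, hM.card_tri]

lemma IsMerging.sum_inner (hT : IsTriangleMap σ φ tri)
    (hM : IsMerging σ φ tri (fun d => ¬G d) comp O t) (hA : IsAngleMap σ φ tri G src x)
    {c : C} (hc : c ≠ O) : ∑ d with comp d = c, x d = 3 * t c := by
  rw [hM.filter_comp_eq hc, hT.sum_tri_eq hM]
  have : ∀ d ∈ Finset.univ.filter (fun d => tri d ∧ comp d = c),
      x d + x (φ d) + x (φ (φ d)) = 3 := by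
    intro d hd
    simp only [Finset.mem_filter, Finset.mem_univ, true_and] at hd
    exact hA.sum_tri d hd.1
  rw [Finset.sum_congr rfl this, Finset.sum_const, hM.card_tri, nsmul_eq_mul]
  push_cast
  ring

/-- `σ` pairs off the sides outside `G` without fixed points. This parity excludes a lone triangle
with exactly one side outside `G`. -/
lemma IsMerging.even_card (hT : IsTriangleMap σ φ tri)
    (hM : IsMerging σ φ tri (fun d => ¬G d) comp O t) (hA : IsAngleMap σ φ tri G src x) (c : C) :
    Even (Finset.univ.filter fun d => ¬G d ∧ comp d = c).card := by
  have hmem : ∀ d, ¬G d ∧ comp d = c → ¬G (σ d) ∧ comp (σ d) = c := fun d hd =>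
    ⟨mt (hA.symm_iff d).1 hd.1, (hM.comp_symm d hd.1).trans hd.2⟩
  rw [← ZMod.natCast_eq_zero_iff_even, Finset.cast_card]
  refine Finset.sum_involution (fun d _ => σ d) (fun _ _ => by decide) (fun d _ _ => hT.ne_self d)
    (fun d hd => ?_) (fun d _ => hT.invol d)
  simp only [Finset.mem_filter, Finset.mem_univ, true_and] at hd ⊢
  exact hmem d hd

/-- Three corners of a triangle with unit sides. -/
lemma IsMerging.one_le_cornerAngle (hT : IsTriangleMap σ φ tri)
    (hM : IsMerging σ φ tri (fun d => ¬G d) comp O t)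
    (hA : IsAngleMap σ φ tri G src x) (hψ : IsCornerMap G src comp ψ) {c : C} (hc : c ≠ O)
    (hr : (Finset.univ.filter fun d => ¬G d ∧ comp d = c).card = 0) {d : B} (hd : comp d = c) :
    1 ≤ cornerAngle ψ x d := by
  have hG : ∀ d, comp d = c → G d := by
    intro d hd
    by_contra hG
    have : d ∈ Finset.univ.filter fun d => ¬G d ∧ comp d = c := by simp [hG, hd]
    rw [Finset.card_eq_zero.1 hr] at this
    exact absurd this (Finset.notMem_empty _)
  have htri : ∀ d, comp d = c → tri d := fun d hd => hM.tri_of_comp_ne (hd ▸ hc)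
  have h1 := (hM.comp_next d (htri d hd)).trans hd
  have h2 := (hM.comp_next _ (htri _ h1)).trans h1
  rw [← hA.equilateral hT (htri d hd) (hG _ hd) (hG _ h1) (hG _ h2)]
  have := le_cornerAngle hA.nonneg {d} (d := d) (ψ := ψ) (by simpa using hψ.self d (hG d hd))
  simpa using this

/-- A face made of two triangles with four unit sides is a rhombus. -/
lemma IsMerging.sum_excess_rhombus (hT : IsTriangleMap σ φ tri)
    (hM : IsMerging σ φ tri (fun d => ¬G d) comp O t) (hA : IsAngleMap σ φ tri G src x)
    (hψ : IsCornerMap G src comp ψ) {c : C} (hc : c ≠ O) (ht : t c = 2)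
    (hk : (Finset.univ.filter fun d => G d ∧ comp d = c).card = 4) :
    0 ≤ ∑ d with G d ∧ comp d = c, excess (cornerAngle ψ x d) := by
  have hcard := hM.card_inner hc
  have hr : (Finset.univ.filter fun d => ¬G d ∧ comp d = c).card = 2 := by omega
  have hall : (Finset.univ.filter fun d => comp d = c).card = 6 := by
    rw [hM.filter_comp_eq hc, hM.card_tri, ht]
  obtain ⟨d, hRd, hd, hs0, hs1, hs2⟩ := hM.exists_symm c hc ht.ge
  have htri : ∀ d, comp d = c → tri d := fun d hd => hM.tri_of_comp_ne (hd ▸ hc)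
  have hnext : ∀ d, comp d = c → comp (φ d) = c := fun d hd =>
    (hM.comp_next d (htri d hd)).trans hd
  have hσ : comp (σ d) = c := (hM.comp_symm d hRd).trans hd
  have htd := htri d hd
  have hts := htri _ hσ
  obtain ⟨p1, p2, p3⟩ := hA.src_distinct hT htd
  obtain ⟨q1, q2, q3⟩ := hA.src_distinct hT hts
  have e1 := hA.src_next d htd
  have e2 := hA.src_next _ hts
  rw [hT.invol] at e2
  have hRset : ({d, σ d} : Finset B) = Finset.univ.filter fun d => ¬G d ∧ comp d = c := by
    refine Finset.eq_of_subset_of_card_le ?_ ?_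
    · intro b hb
      simp only [Finset.mem_insert, Finset.mem_singleton] at hb
      rcases hb with rfl | rfl
      · simp [hRd, hd]
      · simp [hA.symm_iff, hRd, hσ]
    · rw [hr, Finset.card_pair hs0.symm]
  have hG : ∀ b, comp b = c → b ≠ d → b ≠ σ d → G b := by
    intro b hb h1 h2
    by_contra hGb
    have : b ∈ ({d, σ d} : Finset B) := by rw [hRset]; simp [hGb, hb]
    simp [h1, h2] at this
  -- the six darts are distinct
  have n1 : φ d ≠ d := fun h => p1 (by rw [h])
  have n2 : φ (φ d) ≠ d := fun h => p3 (by rw [h])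
  have n3 : φ (φ d) ≠ φ d := fun h => p2 (by rw [h])
  have m1 : φ (σ d) ≠ σ d := fun h => q1 (by rw [h])
  have m2 : φ (φ (σ d)) ≠ σ d := fun h => q3 (by rw [h])
  have m3 : φ (φ (σ d)) ≠ φ (σ d) := fun h => q2 (by rw [h])
  have c3 := hT.next_three d htd
  have c3' := hT.next_three _ hts
  have k1 : φ (σ d) ≠ d := fun h => hs2 (by rw [← c3', h])
  have k2 : φ (φ (σ d)) ≠ d := fun h => hs1 (by rw [← c3', h])
  have k3 : φ (σ d) ≠ φ d := fun h => hs0 (by rw [← c3', h, c3])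
  have k4 : φ (φ (σ d)) ≠ φ d := fun h => hs2 (by rw [← c3', h])
  have k5 : φ (σ d) ≠ φ (φ d) := fun h => hs1 (by rw [← c3', h, c3])
  have k6 : φ (φ (σ d)) ≠ φ (φ d) := fun h => hs0 (by rw [← c3', h, c3])
  have hca := hnext d hd
  have hca' := hnext _ hca
  have hcb := hnext _ hσ
  have hcb' := hnext _ hcb
  have ga := hG _ hca n1 hs1.symm
  have ga' := hG _ hca' n2 hs2.symm
  have gb := hG _ hcb k1 m1
  have gb' := hG _ hcb' k2 m2
  have hSset : ({φ d, φ (φ d), φ (σ d), φ (φ (σ d))} : Finset B) =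
      Finset.univ.filter fun d => G d ∧ comp d = c := by
    refine Finset.eq_of_subset_of_card_le ?_ ?_
    · intro b hb
      simp only [Finset.mem_insert, Finset.mem_singleton] at hb
      rcases hb with rfl | rfl | rfl | rfl <;> simp [*]
    · rw [hk, Finset.card_insert_of_notMem, Finset.card_insert_of_notMem, Finset.card_pair m3.symm]
      · simpa using ⟨k5.symm, k6.symm⟩
      · simpa using ⟨n3.symm, k3.symm, k4.symm⟩
  have hψmem : ∀ b, comp b = c → ψ b = φ d ∨ ψ b = φ (φ d) ∨ ψ b = φ (σ d) ∨
      ψ b = φ (φ (σ d)) := by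
    intro b hb
    have : ψ b ∈ Finset.univ.filter fun d => G d ∧ comp d = c := by
      simp [hψ.mem, hψ.comp_eq, hb]
    rw [← hSset] at this
    simpa using this
  have hψd : ψ d = φ (σ d) := by
    have hsrc := hψ.src_eq d
    rcases hψmem d hd with h | h | h | h
    · rw [h] at hsrc; exact absurd hsrc.symm p1
    · rw [h] at hsrc; exact absurd hsrc.symm p3
    · exact h
    · rw [h, ← e2] at hsrc; exact absurd hsrc.symm q2
  have hψσ : ψ (σ d) = φ d := by
    have hsrc := hψ.src_eq (σ d)
    rcases hψmem _ hσ with h | h | h | h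
    · exact h
    · rw [h, ← e1] at hsrc; exact absurd hsrc.symm p2
    · rw [h] at hsrc; exact absurd hsrc.symm q1
    · rw [h] at hsrc; exact absurd hsrc.symm q3
  have i1 := hA.isosceles d htd ga ga'
  have i2 := hA.isosceles _ hts gb gb'
  have i3 := hA.rhombus d htd ga ga' hts gb gb'
  have s1 := hA.sum_tri d htd
  have s2 := hA.sum_tri _ hts
  have l1 := le_cornerAngle hA.nonneg {φ d, σ d} (d := φ d) (ψ := ψ)
    (by simpa using ⟨hψ.self _ ga, hψσ⟩)
  have l2 := le_cornerAngle hA.nonneg {φ (φ d)} (d := φ (φ d)) (ψ := ψ)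
    (by simpa using hψ.self _ ga')
  have l3 := le_cornerAngle hA.nonneg {φ (σ d), d} (d := φ (σ d)) (ψ := ψ)
    (by simpa using ⟨hψ.self _ gb, hψd⟩)
  have l4 := le_cornerAngle hA.nonneg {φ (φ (σ d))} (d := φ (φ (σ d))) (ψ := ψ)
    (by simpa using hψ.self _ gb')
  rw [Finset.sum_pair hs1.symm] at l1
  rw [Finset.sum_pair k1] at l3
  rw [Finset.sum_singleton] at l2 l4
  rw [← hSset, Finset.sum_insert (by simpa using ⟨n3.symm, k3.symm, k4.symm⟩),
    Finset.sum_insert (by simpa using ⟨k5.symm, k6.symm⟩), Finset.sum_pair m3.symm]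
  have f1 := excess_mono l1
  have f2 := excess_mono l2
  have f3 := excess_mono l3
  have f4 := excess_mono l4
  -- The triangles are congruent and isosceles over the diagonal: the corners at its ends are 3
  -- minus the apex angle, and both apex angles agree.
  have r1 : x (φ d) + x (σ d) = 3 - x (φ (φ d)) := by linarith
  have r2 : x (φ (σ d)) + x d = 3 - x (φ (φ d)) := by linarith
  have r3 : x (φ (φ (σ d))) = x (φ (φ d)) := by linarith
  rw [r1] at f1
  rw [r2] at f3
  rw [r3] at f4
  have := excess_add_excess_three_sub (x (φ (φ d)))
  linarith

/-- The charge is at least 3t - 2k, where k + r = 3t, r is even and r ≥ 2t - 2. If this is negative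
then (t, k) is (1, 3), (2, 4) or (3, 5): a unit triangle, a rhombus or a pentagon. -/
lemma IsMerging.sum_excess_inner (hT : IsTriangleMap σ φ tri)
    (hM : IsMerging σ φ tri (fun d => ¬G d) comp O t) (hA : IsAngleMap σ φ tri G src x)
    (hψ : IsCornerMap G src comp ψ) {c : C} (hc : c ≠ O) :
    0 ≤ ∑ d with G d ∧ comp d = c, excess (cornerAngle ψ x d) := by
  have hcard := hM.card_inner hc
  have hin := hM.inner c hc
  have heven := hM.even_card hT hA c
  have hsum := (hψ.sum_comp c).trans (hM.sum_inner hT hA hc)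
  have hlow : ∑ d with G d ∧ comp d = c, (cornerAngle ψ x d - 2) ≤
      ∑ d with G d ∧ comp d = c, excess (cornerAngle ψ x d) :=
    Finset.sum_le_sum fun d _ => sub_two_le_excess _
  rw [Finset.sum_sub_distrib, hsum, Finset.sum_const, nsmul_eq_mul] at hlow
  generalize hk : (Finset.univ.filter fun d => G d ∧ comp d = c).card = k at hcard hlow
  generalize hr : (Finset.univ.filter fun d => ¬G d ∧ comp d = c).card = r at hcard hin heven
  by_cases h32 : 2 * k ≤ 3 * t c
  · have : (2 : ℝ) * k ≤ 3 * t c := by exact_mod_cast h32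
    linarith
  · obtain ⟨j, hj⟩ := heven
    have hcases : (t c = 1 ∧ r = 0) ∨ (t c = 2 ∧ k = 4) ∨ (t c = 3 ∧ k = 5) := by
      have hj2 : j ≤ 2 := by omega
      interval_cases j <;> omega
    rcases hcases with ⟨-, rfl⟩ | ⟨ht, rfl⟩ | ⟨ht, rfl⟩
    · refine Finset.sum_nonneg fun d hd => excess_nonneg ?_
      simp only [Finset.mem_filter, Finset.mem_univ, true_and] at hd
      exact hM.one_le_cornerAngle hT hA hψ hc hr hd.2
    · exact hM.sum_excess_rhombus hT hA hψ hc ht hk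
    · refine sum_excess_five _ _ hk ?_
      rw [hsum, ht]; norm_num

/-- The bound 2t ≤ r for the triangles in `O` gives k ≤ t + (number of darts outside triangles).
Each of these triangles contributes 3 to the angle sum and each of these darts at least 3. -/
lemma IsMerging.three_mul_card_le_outer (hT : IsTriangleMap σ φ tri)
    (hM : IsMerging σ φ tri (fun d => ¬G d) comp O t) (hA : IsAngleMap σ φ tri G src x) :
    3 * ((Finset.univ.filter fun d => G d ∧ comp d = O).card : ℝ) ≤ ∑ d with comp d = O, x d := by
  have hsplit := card_filter_comp_split (G := G) (comp := comp) O
  have hsplit' := card_filter_comp_split (G := tri) (comp := comp) O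
  have hout := hM.outer
  have hct := hM.card_tri O
  rw [sum_filter_comp_split (G := tri), hT.sum_tri_eq hM]
  have h1 : ∑ d with tri d ∧ comp d = O, (x d + x (φ d) + x (φ (φ d))) =
      ∑ d with tri d ∧ comp d = O, (3 : ℝ) := by
    refine Finset.sum_congr rfl fun d hd => ?_
    simp only [Finset.mem_filter, Finset.mem_univ, true_and] at hd
    exact hA.sum_tri d hd.1
  have h2 : ∑ d with ¬tri d ∧ comp d = O, (3 : ℝ) ≤ ∑ d with ¬tri d ∧ comp d = O, x d := by
    refine Finset.sum_le_sum fun d hd => ?_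
    simp only [Finset.mem_filter, Finset.mem_univ, true_and] at hd
    exact hA.outer d hd.1
  rw [h1]
  rw [Finset.sum_const, nsmul_eq_mul] at h2 ⊢
  rw [hct]
  have h3 : (Finset.univ.filter fun d => G d ∧ comp d = O).card ≤
      t O + (Finset.univ.filter fun d => ¬tri d ∧ comp d = O).card := by omega
  have h3' : ((Finset.univ.filter fun d => G d ∧ comp d = O).card : ℝ) ≤
      t O + (Finset.univ.filter fun d => ¬tri d ∧ comp d = O).card := by exact_mod_cast h3
  push_cast
  linarith

/-- The length of the outer boundary is at most four times the number of vertices of degree at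
most `4`. -/
lemma IsMerging.card_outer_le [Fintype C] [Fintype V] (hT : IsTriangleMap σ φ tri)
    (hM : IsMerging σ φ tri (fun d => ¬G d) comp O t) (hA : IsAngleMap σ φ tri G src x)
    (hψ : IsCornerMap G src comp ψ) :
    (Finset.univ.filter fun d => G d ∧ comp d = O).card ≤
      4 * (Finset.univ.filter fun v => (Finset.univ.filter fun d => G d ∧ src d = v).card ≤ 4).card := by
  have h1 : ∑ d with G d ∧ comp d = O, excess (cornerAngle ψ x d) ≤
      ∑ d with G d, excess (cornerAngle ψ x d) := by
    rw [← Finset.sum_fiberwise (Finset.univ.filter G) comp, ← Finset.add_sum_erase _ _ (Finset.mem_univ O)]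
    simp only [Finset.filter_filter]
    refine le_add_of_nonneg_right (Finset.sum_nonneg fun c hc => ?_)
    exact hM.sum_excess_inner hT hA hψ (Finset.ne_of_mem_erase hc)
  have h2 : ∑ d with G d, excess (cornerAngle ψ x d) ≤
      ∑ v, if (Finset.univ.filter fun d => G d ∧ src d = v).card ≤ 4 then (4 : ℝ) else 0 := by
    rw [← Finset.sum_fiberwise (Finset.univ.filter G) src]
    simp only [Finset.filter_filter]
    refine Finset.sum_le_sum fun v _ => sum_excess_le_of_sum_eq_six _ _ ?_
    rw [hψ.sum_src, hA.sum_src]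
  have h3 : ∑ d with G d ∧ comp d = O, (cornerAngle ψ x d - 2) ≤
      ∑ d with G d ∧ comp d = O, excess (cornerAngle ψ x d) :=
    Finset.sum_le_sum fun d _ => sub_two_le_excess _
  rw [Finset.sum_sub_distrib, hψ.sum_comp, Finset.sum_const, nsmul_eq_mul] at h3
  have h4 := hM.three_mul_card_le_outer hT hA
  rw [← Finset.sum_filter, Finset.sum_const, nsmul_eq_mul] at h2
  have : ((Finset.univ.filter fun d => G d ∧ comp d = O).card : ℝ) ≤
      4 * (Finset.univ.filter fun v =>
        (Finset.univ.filter fun d => G d ∧ src d = v).card ≤ 4).card := by linarith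
  exact_mod_cast this

/-- A count of the triangular faces with unit sides. -/
lemma IsMerging.card_darts_le [Fintype C] [Fintype V] (hT : IsTriangleMap σ φ tri)
    (hM : IsMerging σ φ tri (fun d => ¬G d) comp O t) (hA : IsAngleMap σ φ tri G src x) :
    (Finset.univ.filter G).card + (Finset.univ.filter fun d => G d ∧ comp d = O).card ≤
      4 * Fintype.card V + (Finset.univ.filter fun c => c ≠ O ∧ t c = 1 ∧
        (Finset.univ.filter fun d => ¬G d ∧ comp d = c).card = 0).card := by
  have hx : (∑ d, x d) = 6 * Fintype.card V := by
    rw [← Finset.sum_fiberwise Finset.univ src]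
    simp [hA.sum_src, mul_comm]
  rw [← Finset.sum_fiberwise Finset.univ comp, ← Finset.add_sum_erase _ _ (Finset.mem_univ O)] at hx
  have hG : (Finset.univ.filter G).card = (Finset.univ.filter fun d => G d ∧ comp d = O).card +
      ∑ c ∈ Finset.univ.erase O, (Finset.univ.filter fun d => G d ∧ comp d = c).card := by
    rw [Finset.card_eq_sum_card_fiberwise (f := comp) (t := Finset.univ) (by simp),
      ← Finset.add_sum_erase _ _ (Finset.mem_univ O)]
    simp only [Finset.filter_filter]
  have houter := hM.three_mul_card_le_outer hT hA
  have hinner : ∀ c ∈ Finset.univ.erase O,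
      ((Finset.univ.filter fun d => G d ∧ comp d = c).card : ℝ) ≤
      2 / 3 * ∑ d with comp d = c, x d + if c ≠ O ∧ t c = 1 ∧
        (Finset.univ.filter fun d => ¬G d ∧ comp d = c).card = 0 then 1 else 0 := by
    intro c hc
    have hc := Finset.ne_of_mem_erase hc
    rw [hM.sum_inner hT hA hc]
    have hcard := hM.card_inner hc
    have hin := hM.inner c hc
    obtain ⟨j, hj⟩ := hM.even_card hT hA c
    -- From r ≥ 2t - 2 one has k ≤ t + 2 ≤ 2t for t ≥ 2; for t = 1 parity leaves only r = 0 as an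
    -- exception.
    have : (Finset.univ.filter fun d => G d ∧ comp d = c).card ≤ 2 * t c +
        if c ≠ O ∧ t c = 1 ∧ (Finset.univ.filter fun d => ¬G d ∧ comp d = c).card = 0
        then 1 else 0 := by
      split_ifs with h
      · omega
      · have : ¬(t c = 1 ∧ (Finset.univ.filter fun d => ¬G d ∧ comp d = c).card = 0) :=
          fun h' => h ⟨hc, h'⟩
        omega
    have : ((Finset.univ.filter fun d => G d ∧ comp d = c).card : ℝ) ≤ 2 * t c +
        if c ≠ O ∧ t c = 1 ∧ (Finset.univ.filter fun d => ¬G d ∧ comp d = c).card = 0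
        then 1 else 0 := by exact_mod_cast this
    linarith
  have hsum := Finset.sum_le_sum hinner
  rw [Finset.sum_add_distrib, ← Finset.mul_sum, ← Finset.sum_filter, Finset.sum_const,
    nsmul_eq_mul, mul_one] at hsum
  have hle : ((Finset.univ.erase O).filter fun c => c ≠ O ∧ t c = 1 ∧
        (Finset.univ.filter fun d => ¬G d ∧ comp d = c).card = 0).card ≤
      (Finset.univ.filter fun c => c ≠ O ∧ t c = 1 ∧
        (Finset.univ.filter fun d => ¬G d ∧ comp d = c).card = 0).card :=
    Finset.card_le_card (Finset.filter_subset_filter _ (Finset.erase_subset _ _))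
  have hle' : (((Finset.univ.erase O).filter fun c => c ≠ O ∧ t c = 1 ∧
        (Finset.univ.filter fun d => ¬G d ∧ comp d = c).card = 0).card : ℝ) ≤
      (Finset.univ.filter fun c => c ≠ O ∧ t c = 1 ∧
        (Finset.univ.filter fun d => ¬G d ∧ comp d = c).card = 0).card := by exact_mod_cast hle
  have hG' : ((Finset.univ.filter G).card : ℝ) =
      (Finset.univ.filter fun d => G d ∧ comp d = O).card +
      ∑ c ∈ Finset.univ.erase O, ((Finset.univ.filter fun d => G d ∧ comp d = c).card : ℝ) := by
    rw [hG]; push_cast; rfl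
  have : ((Finset.univ.filter G).card : ℝ) +
      (Finset.univ.filter fun d => G d ∧ comp d = O).card ≤ 4 * Fintype.card V +
      (Finset.univ.filter fun c => c ≠ O ∧ t c = 1 ∧
        (Finset.univ.filter fun d => ¬G d ∧ comp d = c).card = 0).card := by
    linarith
  exact_mod_cast this

end corner

/-! ### Length and enclosed area of the outer boundary. -/

section boundary

variable {B C V : Type*} [Fintype B] [DecidableEq B] [Fintype C] [DecidableEq C]
  [DecidableEq V] {σ φ : B → B} {tri G : B → Prop} [DecidablePred tri] [DecidablePred G]
  {src : B → V} {x : B → ℝ} {comp : B → C} {O : C} {t : C → ℕ}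

/-- The sum of an alternating function along the boundary of an inner face. -/
lemma IsMerging.sum_boundary_inner (hT : IsTriangleMap σ φ tri)
    (hM : IsMerging σ φ tri (fun d => ¬G d) comp O t) (hA : IsAngleMap σ φ tri G src x)
    (a : B → ℝ) (ha : ∀ d, a (σ d) = -a d) {c : C} (hc : c ≠ O) :
    ∑ d with G d ∧ comp d = c, a d =
      1 / 3 * ∑ d with tri d ∧ comp d = c, (a d + a (φ d) + a (φ (φ d))) := by
  have hR : ∑ d with ¬G d ∧ comp d = c, a d = 0 := by
    refine Finset.sum_involution (fun d _ => σ d) (fun d _ => by rw [ha]; ring)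
      (fun d _ _ => hT.ne_self d) (fun d hd => ?_) (fun d _ => hT.invol d)
    simp only [Finset.mem_filter, Finset.mem_univ, true_and] at hd ⊢
    exact ⟨mt (hA.symm_iff d).1 hd.1, (hM.comp_symm d hd.1).trans hd.2⟩
  rw [← hT.sum_tri_eq hM, ← hM.filter_comp_eq hc, sum_filter_comp_split (G := G), hR, add_zero]

/-- A discrete Stokes formula: an alternating function sums to 0 over all darts of `G`, and along
the boundary of an inner face it sums to the circulation around the triangles inside. -/
lemma IsMerging.sum_boundary_outer (hT : IsTriangleMap σ φ tri)
    (hM : IsMerging σ φ tri (fun d => ¬G d) comp O t) (hA : IsAngleMap σ φ tri G src x)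
    (a : B → ℝ) (ha : ∀ d, a (σ d) = -a d) :
    ∑ d with G d ∧ comp d = O, a d = - ∑ c ∈ Finset.univ.erase O,
      1 / 3 * ∑ d with tri d ∧ comp d = c, (a d + a (φ d) + a (φ (φ d))) := by
  have hG : ∑ d with G d, a d = 0 := by
    refine Finset.sum_involution (fun d _ => σ d) (fun d _ => by rw [ha]; ring)
      (fun d _ _ => hT.ne_self d) (fun d hd => ?_) (fun d _ => hT.invol d)
    simp only [Finset.mem_filter, Finset.mem_univ, true_and] at hd ⊢
    exact (hA.symm_iff d).2 hd
  rw [← Finset.sum_fiberwise _ comp, ← Finset.add_sum_erase _ _ (Finset.mem_univ O)] at hG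
  simp only [Finset.filter_filter] at hG
  rw [Finset.sum_congr rfl fun c hc =>
    hM.sum_boundary_inner hT hA a ha (Finset.ne_of_mem_erase hc)] at hG
  linarith

lemma IsMerging.sum_boundary_outer_le (hT : IsTriangleMap σ φ tri)
    (hM : IsMerging σ φ tri (fun d => ¬G d) comp O t) (hA : IsAngleMap σ φ tri G src x)
    (a : B → ℝ) (ha : ∀ d, a (σ d) = -a d)
    (ha0 : ∀ d, tri d → 0 ≤ a d + a (φ d) + a (φ (φ d))) {α : ℝ}
    (ha1 : ∀ d, tri d → G d → G (φ d) → G (φ (φ d)) → a d + a (φ d) + a (φ (φ d)) = α) :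
    ∑ d with G d ∧ comp d = O, a d ≤ - ((Finset.univ.filter fun c => c ≠ O ∧ t c = 1 ∧
        (Finset.univ.filter fun d => ¬G d ∧ comp d = c).card = 0).card * α) := by
  rw [hM.sum_boundary_outer hT hA a ha, neg_le_neg_iff, ← nsmul_eq_mul, ← Finset.sum_const]
  refine (Finset.sum_le_sum fun c hc => ?_).trans
    (Finset.sum_le_sum_of_subset_of_nonneg (fun c hc => ?_) fun c _ _ => ?_)
  · simp only [Finset.mem_filter, Finset.mem_univ, true_and] at hc
    obtain ⟨hcO, htc, hr⟩ := hc
    have hG : ∀ d, comp d = c → G d := by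
      intro d hd
      by_contra hG
      have : d ∈ Finset.univ.filter fun d => ¬G d ∧ comp d = c := by simp [hG, hd]
      rw [Finset.card_eq_zero.1 hr] at this
      exact absurd this (Finset.notMem_empty _)
    have : ∀ d ∈ Finset.univ.filter (fun d => tri d ∧ comp d = c),
        a d + a (φ d) + a (φ (φ d)) = α := by
      intro d hd
      simp only [Finset.mem_filter, Finset.mem_univ, true_and] at hd
      have h1 := (hM.comp_next d hd.1).trans hd.2
      have h2 := (hM.comp_next _ (hT.tri_next d hd.1)).trans h1
      exact ha1 d hd.1 (hG _ hd.2) (hG _ h1) (hG _ h2)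
    rw [Finset.sum_congr rfl this, Finset.sum_const, hM.card_tri, htc, nsmul_eq_mul]
    push_cast
    linarith
  · simp only [Finset.mem_filter, Finset.mem_univ, true_and] at hc
    simp [hc.1]
  · refine mul_nonneg (by norm_num) (Finset.sum_nonneg fun d hd => ?_)
    simp only [Finset.mem_filter, Finset.mem_univ, true_and] at hd
    exact ha0 d hd.1

/-- The outer boundary is a union of closed walks. -/
lemma IsMerging.exists_perm (hT : IsTriangleMap σ φ tri)
    (hM : IsMerging σ φ tri (fun d => ¬G d) comp O t) (hA : IsAngleMap σ φ tri G src x) :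
    ∃ τ : Equiv.Perm {d // G d ∧ comp d = O}, ∀ d, src (τ d).1 = src (σ d.1) := by
  have hbal : ∀ v, (Finset.univ.filter fun d => (G d ∧ comp d = O) ∧ src (σ d) = v).card =
      (Finset.univ.filter fun d => (G d ∧ comp d = O) ∧ src d = v).card := by
    intro v
    -- Net arrivals at `v`. The circulation of this function around a triangle is 0, so as many
    -- outer boundary darts enter `v` as leave it, and they can be matched.
    let a : B → ℝ := fun d => (if src (σ d) = v then 1 else 0) - (if src d = v then 1 else 0)
    have ha : ∀ d, a (σ d) = -a d := by
      intro d
      simp only [a, hT.invol]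
      ring
    have h := hM.sum_boundary_outer hT hA a ha
    have hzero : ∀ c ∈ Finset.univ.erase O,
        1 / 3 * ∑ d with tri d ∧ comp d = c, (a d + a (φ d) + a (φ (φ d))) = 0 := by
      intro c _
      rw [Finset.sum_eq_zero, mul_zero]
      intro d hd
      simp only [Finset.mem_filter, Finset.mem_univ, true_and] at hd
      have h1 := hA.src_next d hd.1
      have h2 := hA.src_next _ (hT.tri_next d hd.1)
      have h3 := hA.src_next _ (hT.tri_next _ (hT.tri_next d hd.1))
      rw [hT.next_three d hd.1] at h3
      simp only [a, ← h1, ← h2, ← h3]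
      ring
    rw [Finset.sum_eq_zero hzero, neg_zero, Finset.sum_sub_distrib, ← Finset.sum_filter,
      ← Finset.sum_filter, Finset.filter_filter, Finset.filter_filter, Finset.sum_const,
      Finset.sum_const, nsmul_eq_mul, nsmul_eq_mul, mul_one, mul_one, sub_eq_zero] at h
    exact_mod_cast h
  have e : ∀ v, Nonempty ({d : {d // G d ∧ comp d = O} // src (σ d.1) = v} ≃
      {d : {d // G d ∧ comp d = O} // src d.1 = v}) := by
    intro v
    refine ⟨((Equiv.subtypeSubtypeEquivSubtypeInter (fun d => G d ∧ comp d = O)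
      (fun d => src (σ d) = v)).trans (Fintype.equivOfCardEq ?_)).trans
      (Equiv.subtypeSubtypeEquivSubtypeInter (fun d => G d ∧ comp d = O)
      (fun d => src d = v)).symm⟩
    rw [Fintype.card_subtype, Fintype.card_subtype]
    exact hbal v
  exact ⟨Equiv.ofFiberEquiv (f := fun d : {d // G d ∧ comp d = O} => src (σ d.1))
    (g := fun d : {d // G d ∧ comp d = O} => src d.1) fun v => (e v).some,
    fun d => Equiv.ofFiberEquiv_map (f := fun d : {d // G d ∧ comp d = O} => src (σ d.1))
      (g := fun d : {d // G d ∧ comp d = O} => src d.1) _ d⟩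

/-- The isoperimetric inequality for the outer boundary. -/
lemma IsMerging.card_mul_lt (hT : IsTriangleMap σ φ tri)
    (hM : IsMerging σ φ tri (fun d => ¬G d) comp O t) (hA : IsAngleMap σ φ tri G src x)
    (z : V → ℂ) (hz : ∀ d, G d → ‖z (src (σ d)) - z (src d)‖ = 1)
    (ha0 : ∀ d, tri d → 0 ≤ planeDet (z (src d)) (z (src (σ d))) +
      planeDet (z (src (φ d))) (z (src (σ (φ d)))) +
      planeDet (z (src (φ (φ d)))) (z (src (σ (φ (φ d)))))) {α : ℝ}
    (ha1 : ∀ d, tri d → G d → G (φ d) → G (φ (φ d)) → planeDet (z (src d)) (z (src (σ d))) +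
      planeDet (z (src (φ d))) (z (src (σ (φ d)))) +
      planeDet (z (src (φ (φ d)))) (z (src (σ (φ (φ d))))) = α)
    (hα : 0 < α) :
    (Finset.univ.filter fun c => c ≠ O ∧ t c = 1 ∧
        (Finset.univ.filter fun d => ¬G d ∧ comp d = c).card = 0).card = 0 ∨
    (Finset.univ.filter fun c => c ≠ O ∧ t c = 1 ∧
        (Finset.univ.filter fun d => ¬G d ∧ comp d = c).card = 0).card * α <
      ((Finset.univ.filter fun d => G d ∧ comp d = O).card : ℝ) ^ 2 / (2 * Real.pi) := by
  have h1 := hM.sum_boundary_outer_le hT hA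
    (fun d => planeDet (z (src d)) (z (src (σ d))))
    (fun d => by rw [hT.invol, planeDet_swap]) ha0 ha1
  obtain ⟨τ, hτ⟩ := hM.exists_perm hT hA
  rcases isEmpty_or_nonempty {d // G d ∧ comp d = O} with hemp | hne
  · left
    rw [Finset.sum_eq_zero fun d hd => (hemp.false ⟨d, (Finset.mem_filter.1 hd).2⟩).elim,
      neg_nonneg] at h1
    by_contra h0
    have : (0 : ℝ) < (Finset.univ.filter fun c => c ≠ O ∧ t c = 1 ∧
        (Finset.univ.filter fun d => ¬G d ∧ comp d = c).card = 0).card := by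
      exact_mod_cast Nat.pos_of_ne_zero h0
    exact absurd h1 (not_le.2 (mul_pos this hα))
  right
  -- The outer boundary is traversed with negative area; conjugation reverses the orientation. The
  -- walks need not be simple, as the isoperimetric bound concerns signed area.
  have h2 := sum_planeDet_perm_lt τ (fun d => starRingEnd ℂ (z (src d.1))) (fun d => by
    rw [← map_sub, Complex.norm_conj, hτ]
    exact hz d.1 d.2.1)
  rw [Fintype.card_subtype] at h2
  have h3 : ∑ d : {d // G d ∧ comp d = O}, planeDet (starRingEnd ℂ (z (src d.1)))
      (starRingEnd ℂ (z (src (τ d).1))) =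
      - ∑ d with G d ∧ comp d = O, planeDet (z (src d)) (z (src (σ d))) := by
    rw [Finset.sum_subtype (p := fun d => G d ∧ comp d = O) _ (by simp), ← Finset.sum_neg_distrib]
    refine Finset.sum_congr rfl fun d _ => ?_
    rw [hτ]
    simp only [planeDet_apply, Complex.conj_re, Complex.conj_im]
    ring
  rw [h3] at h2
  linarith

end boundary

/-! ### The geometric drawing as an instance of the combinatorial structures. -/

lemma angle_eq_of_norm_eq {a b a' b' : ℂ} (h1 : ‖a‖ = ‖a'‖) (h2 : ‖b‖ = ‖b'‖)
    (h3 : ‖a - b‖ = ‖a' - b'‖) :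
    InnerProductGeometry.angle a b = InnerProductGeometry.angle a' b' := by
  unfold InnerProductGeometry.angle
  rw [real_inner_eq_norm_mul_self_add_norm_mul_self_sub_norm_sub_mul_self_div_two,
    real_inner_eq_norm_mul_self_add_norm_mul_self_sub_norm_sub_mul_self_div_two, h1, h2, h3]

namespace IsRotation

variable {V : Type*} {z : V → ℂ} {T : SimpleGraph V} [Fintype V] [Fintype T.Dart] [DecidableEq V]
  {N : Equiv.Perm T.Dart}

/-- A dart is the first side of a triangle if it makes an angle less than `π` with the next one. -/
def IsTri (z : V → ℂ) (N : Equiv.Perm T.Dart) (d : T.Dart) : Prop :=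
  0 < planeDet (dartDir z d) (dartDir z (N d))

lemma isTri_face (hT : Maximal (IsPlaneDrawing z) T) (hN : IsRotation z N) {d : T.Dart}
    (hd : IsTri z N d) : IsTri z N (N.symm d.symm) := by
  unfold IsTri
  rw [Equiv.apply_symm_apply, (hN.exists_triangle hT d hd).2.2]
  exact hd

lemma face_snd (hT : Maximal (IsPlaneDrawing z) T) (hN : IsRotation z N) {d : T.Dart}
    (hd : IsTri z N d) : (N.symm d.symm).snd = (N d).snd := (hN.exists_triangle hT d hd).2.1

lemma face_fst (hN : IsRotation z N) (d : T.Dart) : (N.symm d.symm).fst = d.snd := by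
  rw [← hN.fst, Equiv.apply_symm_apply]; rfl

lemma face_face_snd (hT : Maximal (IsPlaneDrawing z) T) (hN : IsRotation z N) {d : T.Dart}
    (hd : IsTri z N d) : (N.symm (N.symm d.symm).symm).snd = d.fst := by
  rw [hN.face_snd hT (hN.isTri_face hT hd), Equiv.apply_symm_apply]; rfl

lemma face_face_fst (hT : Maximal (IsPlaneDrawing z) T) (hN : IsRotation z N) {d : T.Dart}
    (hd : IsTri z N d) : (N.symm (N.symm d.symm).symm).fst = (N d).snd := by
  rw [hN.face_fst, hN.face_snd hT hd]

lemma isTriangleMap (hT : Maximal (IsPlaneDrawing z) T) (hN : IsRotation z N) :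
    IsTriangleMap SimpleGraph.Dart.symm (fun d => N.symm d.symm) (IsTri z N) where
  invol := SimpleGraph.Dart.symm_symm
  ne_self := SimpleGraph.Dart.symm_ne
  tri_next := fun d hd => hN.isTri_face hT hd
  next_three := fun d hd => by
    have h1 := hN.isTri_face hT hd
    have h2 := hN.isTri_face hT h1
    refine SimpleGraph.Dart.ext _ _ (Prod.ext ?_ ?_)
    · exact (hN.face_fst _).trans (hN.face_face_snd hT hd)
    · exact (hN.face_face_snd hT h1).trans (hN.face_fst d)
  next_ne := fun d _ h => d.adj.ne (by
    have := hN.face_fst d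
    rwa [show N.symm d.symm = d from h] at this)

lemma ccwAngle_eq (hN : IsRotation z N) {d : T.Dart} (hd : IsTri z N d) :
    ccwAngle (dartDir z d) (dartDir z (N d)) =
      InnerProductGeometry.angle (z d.snd - z d.fst) (z (N d).snd - z d.fst) := by
  rw [ccwAngle_eq_angle hd, dartDir, dartDir, hN.fst]

lemma ccwAngle_face_eq (hT : Maximal (IsPlaneDrawing z) T) (hN : IsRotation z N) {d : T.Dart}
    (hd : IsTri z N d) :
    ccwAngle (dartDir z (N.symm d.symm)) (dartDir z (N (N.symm d.symm))) =
      InnerProductGeometry.angle (z (N d).snd - z d.snd) (z d.fst - z d.snd) := by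
  rw [hN.ccwAngle_eq (hN.isTri_face hT hd), hN.face_fst, hN.face_snd hT hd, Equiv.apply_symm_apply]
  rfl

lemma ccwAngle_face_face_eq (hT : Maximal (IsPlaneDrawing z) T) (hN : IsRotation z N) {d : T.Dart}
    (hd : IsTri z N d) :
    ccwAngle (dartDir z (N.symm (N.symm d.symm).symm))
      (dartDir z (N (N.symm (N.symm d.symm).symm))) =
      InnerProductGeometry.angle (z d.fst - z (N d).snd) (z d.snd - z (N d).snd) := by
  rw [hN.ccwAngle_face_eq hT (hN.isTri_face hT hd), Equiv.apply_symm_apply, hN.face_snd hT hd,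
    hN.face_fst]
  rfl

/-- The angle map of a maximal plane drawing `T` relative to a subgraph `G` with unit edges. -/
lemma isAngleMap (hT : Maximal (IsPlaneDrawing z) T) (hN : IsRotation z N) {G : SimpleGraph V}
    (hG : ∀ u v, G.Adj u v → ‖z v - z u‖ = 1) (hdart : ∀ v, ∃ d : T.Dart, d.fst = v) :
    IsAngleMap SimpleGraph.Dart.symm (fun d => N.symm d.symm) (IsTri z N)
      (fun d : T.Dart => G.Adj d.fst d.snd) (fun d => d.fst)
      (fun d => 3 / Real.pi * ccwAngle (dartDir z d) (dartDir z (N d))) where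
  symm_iff := fun d => G.adj_comm _ _
  src_next := fun d _ => hN.face_fst d
  src_ne := fun d => d.adj.ne'
  nonneg := fun d => mul_nonneg (by positivity) ccwAngle_pos.le
  sum_tri := fun d hd => by
    have h := EuclideanGeometry.angle_add_angle_add_angle_eq_pi (p₁ := z d.snd) (p₂ := z d.fst)
      (z (N d).snd) (fun h => d.adj.ne (hT.prop.injective h))
    simp only [EuclideanGeometry.angle, vsub_eq_sub] at h
    rw [← mul_add, ← mul_add]
    rw [hN.ccwAngle_eq hd, hN.ccwAngle_face_eq hT hd, hN.ccwAngle_face_face_eq hT hd,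
      add_right_comm, h]
    exact div_mul_cancel₀ _ Real.pi_pos.ne'
  outer := fun d hd => by
    have h := mt (ccwAngle_lt_pi_iff (hT.prop.dartDir_ne_zero d) (hT.prop.dartDir_ne_zero (N d))).1 hd
    rw [not_lt] at h
    have hpi := Real.pi_pos
    rw [div_mul_eq_mul_div, le_div_iff₀ hpi]
    linarith
  sum_src := fun v => by
    obtain ⟨d, rfl⟩ := hdart v
    rw [← Finset.mul_sum, hN.sum d]
    have hpi := Real.pi_pos.ne'
    field_simp
    norm_num
  isosceles := fun d hd h1 h2 => by
    simp only [hN.face_fst, hN.face_snd hT hd] at h1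
    simp only [hN.face_face_fst hT hd, hN.face_face_snd hT hd] at h2
    have h1 := hG _ _ h1
    have h2 := hG _ _ h2
    congr 1
    rw [hN.ccwAngle_eq hd, hN.ccwAngle_face_eq hT hd, InnerProductGeometry.angle_comm (_ - z d.snd)]
    refine angle_eq_of_norm_eq (norm_sub_rev _ _) ?_ ?_
    · rw [h1, norm_sub_rev, h2]
    · rw [sub_sub_sub_cancel_right, sub_sub_sub_cancel_right, h2, norm_sub_rev, h1]
  rhombus := fun d hd h1 h2 hd' h3 h4 => by
    simp only [hN.face_fst, hN.face_snd hT hd, hN.face_snd hT hd'] at h1 h3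
    simp only [hN.face_face_fst hT hd, hN.face_face_snd hT hd, hN.face_face_fst hT hd',
      hN.face_face_snd hT hd'] at h2 h4
    have h1 := hG _ _ h1
    have h2 := hG _ _ h2
    have h3 := hG _ _ h3
    have h4 := hG _ _ h4
    congr 1
    rw [hN.ccwAngle_eq hd, hN.ccwAngle_eq hd']
    refine angle_eq_of_norm_eq (norm_sub_rev _ _) ?_ ?_
    · rw [norm_sub_rev, h2, norm_sub_rev, h4]
    · rw [sub_sub_sub_cancel_right, sub_sub_sub_cancel_right, norm_sub_rev, h1, norm_sub_rev]
      exact h3.symm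

/-- Turning from `d` to `N d` stays in the same merged face unless `N d` is in `G`, so each dart can
inherit a `G`-dart from its predecessor. Where a face meets a vertex several times the assignment
need not respect the separate corners; the counting does not need this. -/
lemma exists_isCornerMap (hT : Maximal (IsPlaneDrawing z) T) (hN : IsRotation z N)
    {G : SimpleGraph V} [DecidableRel G.Adj] [DecidablePred (IsTri z N)]
    (hdeg : ∀ v, ∃ w, G.Adj v w) (hle : G ≤ T) {C : Type*} [DecidableEq C] {comp : T.Dart → C}
    {O : C} {t : C → ℕ}
    (hM : IsMerging SimpleGraph.Dart.symm (fun d => N.symm d.symm) (IsTri z N)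
      (fun d : T.Dart => ¬G.Adj d.fst d.snd) comp O t) :
    ∃ ψ : T.Dart → T.Dart, IsCornerMap (fun d : T.Dart => G.Adj d.fst d.snd) (fun d => d.fst)
      comp ψ := by
  have hmap := hN.isTriangleMap hT
  have key : ∀ d : T.Dart, ∃ g : T.Dart, G.Adj g.fst g.snd ∧ g.fst = d.fst ∧ comp g = comp d ∧
      (G.Adj d.fst d.snd → g = d) := by
    intro d
    obtain ⟨w, hw⟩ := hdeg d.fst
    refine hN.induct (fun d => ∃ g : T.Dart, G.Adj g.fst g.snd ∧ g.fst = d.fst ∧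
      comp g = comp d ∧ (G.Adj d.fst d.snd → g = d)) ⟨(d.fst, w), hle hw⟩ ⟨_, hw, rfl, rfl, fun _ => rfl⟩
      ?_ d rfl
    rintro d ⟨g, hg, hgd, hgc, -⟩
    by_cases hGN : G.Adj (N d).fst (N d).snd
    · exact ⟨N d, hGN, rfl, rfl, fun _ => rfl⟩
    · refine ⟨g, hg, by rw [hgd, hN.fst], ?_, fun h => absurd h hGN⟩
      have h1 := hM.comp_symm (N d) hGN
      have hface : N.symm (N d).symm.symm = d := by
        rw [SimpleGraph.Dart.symm_symm, Equiv.symm_apply_apply]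
      rw [hgc, ← h1]
      by_cases htri : IsTri z N (N d).symm
      · have h2 := hM.comp_next _ htri
        rw [hface] at h2
        exact h2
      · have hd : ¬IsTri z N d := by
          intro hd
          have h3 : N.symm (N.symm (N.symm d.symm).symm).symm = d := hmap.next_three d hd
          have h4 := hN.isTri_face hT (hN.isTri_face hT hd)
          have h5 := N.symm.injective (h3.trans hface.symm)
          exact htri (SimpleGraph.Dart.symm_involutive.injective h5 ▸ h4)
        rw [hM.comp_outer _ htri, hM.comp_outer _ hd]
  choose ψ h1 h2 h3 h4 using key
  exact ⟨ψ, h1, h2, h3, h4⟩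

end IsRotation

lemma card_darts_eq_degree {V : Type*} [Fintype V] [DecidableEq V] {T G : SimpleGraph V}
    [DecidableRel G.Adj] [Fintype T.Dart] (hle : G ≤ T) (v : V) :
    (Finset.univ.filter fun d : T.Dart => G.Adj d.fst d.snd ∧ d.fst = v).card = G.degree v := by
  rw [← SimpleGraph.card_neighborFinset_eq_degree]
  refine Finset.card_bij (fun d _ => d.snd) ?_ ?_ ?_
  · intro d hd
    simp only [Finset.mem_filter, Finset.mem_univ, true_and] at hd
    rw [SimpleGraph.mem_neighborFinset, ← hd.2]
    exact hd.1
  · intro d hd d' hd' h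
    simp only [Finset.mem_filter, Finset.mem_univ, true_and] at hd hd'
    exact SimpleGraph.Dart.ext _ _ (Prod.ext (hd.2.trans hd'.2.symm) h)
  · intro w hw
    rw [SimpleGraph.mem_neighborFinset] at hw
    exact ⟨⟨(v, w), hle hw⟩, by simpa using hw, rfl⟩

/-- Euler-type counts for a plane drawing with unit edges and no isolated vertices: `k` is the
length of the outer boundary and `s` the number of triangular faces. -/
lemma IsPlaneDrawing.exists_boundary_counts {V : Type*} [Fintype V] {z : V → ℂ}
    {G : SimpleGraph V} [DecidableRel G.Adj] (hP : IsPlaneDrawing z G)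
    (hG : ∀ u v, G.Adj u v → ‖z v - z u‖ = 1) (hdeg : ∀ v, ∃ w, G.Adj v w) :
    ∃ k s : ℕ, k ≤ 4 * (Finset.univ.filter fun v => G.degree v ≤ 4).card ∧
      (∑ v, G.degree v) + k ≤ 4 * Fintype.card V + s ∧
      (s = 0 ∨ s * (√3 / 2) < (k : ℝ) ^ 2 / (2 * Real.pi)) := by
  classical
  obtain ⟨T, hle, hT⟩ := Finite.exists_le_maximal hP
  obtain ⟨N, hN⟩ := hT.prop.exists_isRotation
  have hmap := hN.isTriangleMap hT
  have hA := hN.isAngleMap hT hG fun v => by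
    obtain ⟨w, hw⟩ := hdeg v
    exact ⟨⟨(v, w), hle hw⟩, rfl⟩
  obtain ⟨C, _, comp, O, t, hM⟩ := hmap.exists_merging
    (fun d : T.Dart => ¬G.Adj d.fst d.snd) (fun d hd h => hd h.symm)
  have hM' : IsMerging SimpleGraph.Dart.symm (fun d => N.symm d.symm) (IsRotation.IsTri z N)
      (fun d : T.Dart => ¬G.Adj d.fst d.snd) comp O t := by
    convert hM
  obtain ⟨ψ, hψ⟩ := hN.exists_isCornerMap hT hdeg hle hM'
  refine ⟨_, _, ?_, ?_, hM'.card_mul_lt hmap hA z (fun d hd => hG _ _ hd) ?_ ?_ (by positivity)⟩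
  · have := hM'.card_outer_le hmap hA hψ
    simp only [card_darts_eq_degree hle] at this
    exact this
  · have := hM'.card_darts_le hmap hA
    rwa [Finset.card_eq_sum_card_fiberwise (f := fun d : T.Dart => d.fst) (t := Finset.univ)
      (by simp), Finset.sum_congr rfl fun v _ => by
        rw [Finset.filter_filter, card_darts_eq_degree hle]] at this
  all_goals
    have harea : ∀ d, IsRotation.IsTri z N d → planeDet (z d.fst) (z d.symm.fst) +
        planeDet (z (N.symm d.symm).fst) (z (N.symm d.symm).symm.fst) +
        planeDet (z (N.symm (N.symm d.symm).symm).fst)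
          (z (N.symm (N.symm d.symm).symm).symm.fst) =
        planeDet (dartDir z d) (dartDir z (N d)) := by
      intro d hd
      have e1 : d.symm.fst = d.snd := rfl
      have e2 : (N.symm d.symm).symm.fst = (N d).snd := hN.face_snd hT hd
      have e3 : (N.symm (N.symm d.symm).symm).symm.fst = d.fst := hN.face_face_snd hT hd
      rw [e1, e2, e3, hN.face_fst, hN.face_face_fst hT hd, dartDir, dartDir, hN.fst]
      simp only [planeDet_apply, Complex.sub_re, Complex.sub_im]
      ring
  · intro d hd
    rw [harea d hd]
    exact le_of_lt hd
  · intro d hd h0 h1 h2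
    -- The circulation is twice the area, so a unit equilateral triangle contributes sin(π/3) =
    -- √3/2.
    rw [harea d hd, ← norm_mul_sin_ccwAngle]
    have hx := hA.equilateral hmap hd h0 h1 h2
    have hpi := Real.pi_pos
    have hangle : ccwAngle (dartDir z d) (dartDir z (N d)) = Real.pi / 3 := by
      field_simp at hx ⊢
      linarith
    have n1 : ‖dartDir z d‖ = 1 := hG _ _ h0
    have n2 : ‖dartDir z (N d)‖ = 1 := by
      simp only [hN.face_face_fst hT hd, hN.face_face_snd hT hd] at h2
      rw [dartDir, hN.fst]
      exact hG _ _ h2.symm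
    rw [n1, n2, hangle, Real.sin_pi_div_three]
    ring

/-! ### The numerical conclusion. -/

lemma pi_mul_sqrt_three_lt_six : Real.pi * √3 < 6 := by
  have h1 := Real.pi_lt_d2
  have h2 : √3 < 1.8 := by
    rw [Real.sqrt_lt' (by norm_num)]
    norm_num
  nlinarith [Real.pi_pos, Real.sqrt_nonneg 3]

lemma quarter_sqrt_le (n : ℕ) : 1 / 4 * √(Real.pi * √3 * n) ≤ n := by
  have h := pi_mul_sqrt_three_lt_six
  have h1 : √(Real.pi * √3 * n) ≤ 4 * n := by
    rw [Real.sqrt_le_left (by positivity)]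
    rcases Nat.eq_zero_or_pos n with rfl | hn
    · simp
    · have : (1 : ℝ) ≤ n := by exact_mod_cast hn
      nlinarith [mul_le_mul_of_nonneg_right h.le (by linarith : (0 : ℝ) ≤ n)]
  linarith

lemma quarter_sqrt_lt {n : ℕ} (hn : 0 < n) : 1 / 4 * √(Real.pi * √3 * n) < n := by
  have h := pi_mul_sqrt_three_lt_six
  have hn : (1 : ℝ) ≤ n := by exact_mod_cast hn
  have h1 : √(Real.pi * √3 * n) < 4 * n := by
    rw [Real.sqrt_lt' (by positivity)]
    nlinarith [mul_le_mul_of_nonneg_right h.le (by linarith : (0 : ℝ) ≤ n)]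
  linarith

lemma quarter_sqrt_lt_of_counts {n m k s : ℕ} (hn : 6 ≤ n) (hk : k ≤ 4 * m)
    (hs : n + k ≤ 4 * m + s) (harea : s = 0 ∨ s * (√3 / 2) < (k : ℝ) ^ 2 / (2 * Real.pi)) :
    1 / 4 * √(Real.pi * √3 * n) < m := by
  have hc := pi_mul_sqrt_three_lt_six
  have hpi := Real.pi_pos
  have hc0 : 0 < Real.pi * √3 := by positivity
  have hn' : (6 : ℝ) ≤ n := by exact_mod_cast hn
  have hk' : (k : ℝ) ≤ 4 * m := by exact_mod_cast hk
  have hs' : (n : ℝ) + k ≤ 4 * m + s := by exact_mod_cast hs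
  have hk0 : (0 : ℝ) ≤ k := Nat.cast_nonneg k
  by_contra! hm
  set q := √(Real.pi * √3 * n) with hq
  have hq2 : q ^ 2 = Real.pi * √3 * n := Real.sq_sqrt (by positivity)
  have hq0 : 0 ≤ q := Real.sqrt_nonneg _
  have hmq : 4 * (m : ℝ) ≤ q := by linarith
  rcases harea with rfl | harea
  · have h1 : (n : ℝ) ≤ q := by
      push_cast at hs'
      linarith
    nlinarith
  · have h1 : Real.pi * √3 * s < (k : ℝ) ^ 2 := by
      rw [lt_div_iff₀ (by positivity)] at harea
      linarith
    have h2 : q ^ 2 < (k : ℝ) ^ 2 + Real.pi * √3 * (4 * m - k) := by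
      rw [hq2]
      nlinarith
    -- With c = π√3, the function k² - ck is increasing for k ≥ c, so k may be replaced by q. For k
    -- < c it is at most 0, which gives q < c and contradicts q² = cn with n ≥ 6 > c.
    rcases le_or_gt (Real.pi * √3) k with h3 | h3
    · nlinarith
    · have h4 : q ^ 2 < Real.pi * √3 * (4 * m) := by nlinarith
      have h5 : q ^ 2 < Real.pi * √3 * q := h4.trans_le (by gcongr)
      have h6 : q < Real.pi * √3 := by nlinarith
      nlinarith

/-- With fewer than six vertices all degrees are at most 4. Otherwise every degree is at least 1, so
a vertex of degree at most 4 falls short of 5 by at most 4. -/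
lemma IsPlaneDrawing.quarter_sqrt_lt {V : Type*} [Fintype V] [Nonempty V] {z : V → ℂ}
    {G : SimpleGraph V} [DecidableRel G.Adj] (hP : IsPlaneDrawing z G)
    (hG : ∀ u v, G.Adj u v → ‖z v - z u‖ = 1) (hdeg : ∀ v, ∃ w, G.Adj v w) :
    1 / 4 * √(Real.pi * √3 * Fintype.card V) <
      (Finset.univ.filter fun v => G.degree v ≤ 4).card := by
  rcases Nat.lt_or_ge (Fintype.card V) 6 with hn | hn
  · have : (Finset.univ.filter fun v => G.degree v ≤ 4) = Finset.univ := by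
      refine Finset.filter_true_of_mem fun v _ => ?_
      have := G.degree_lt_card_verts v
      omega
    rw [this, Finset.card_univ]
    exact _root_.quarter_sqrt_lt Fintype.card_pos
  · obtain ⟨k, s, h1, h2, h3⟩ := hP.exists_boundary_counts hG hdeg
    refine quarter_sqrt_lt_of_counts hn h1 ?_ h3
    have h4 : ∑ v : V, 5 ≤ ∑ v, (G.degree v + if G.degree v ≤ 4 then 4 else 0) := by
      refine Finset.sum_le_sum fun v _ => ?_
      have : 0 < G.degree v := (G.degree_pos_iff_exists_adj v).2 (hdeg v)
      split_ifs <;> omega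
    rw [Finset.sum_add_distrib, ← Finset.sum_filter, Finset.sum_const, Finset.sum_const,
      Finset.card_univ, smul_eq_mul, smul_eq_mul] at h4
    omega

/-! ### Passing from matchstick drawings to plane drawings, and back to isolated vertices. -/

/-- The vertices of a matchstick drawing that are not isolated form a plane drawing. -/
lemma IsMatchstickDrawing.exists_isPlaneDrawing {V : Type*} {G : SimpleGraph V}
    {p : V → EuclideanSpace ℝ (Fin 2)} (hp : IsMatchstickDrawing G p) :
    ∃ z : G.support → ℂ, IsPlaneDrawing z (G.induce G.support) ∧
      ∀ u v, (G.induce G.support).Adj u v → ‖z v - z u‖ = 1 := by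
  let e : EuclideanSpace ℝ (Fin 2) ≃ₗᵢ[ℝ] ℂ := Complex.orthonormalBasisOneI.repr.symm
  have hseg : ∀ a b q, q ∈ segment ℝ (e a) (e b) → ∃ r ∈ segment ℝ a b, e r = q := by
    intro a b q hq
    have := image_segment ℝ e.toLinearEquiv.toLinearMap.toAffineMap a b
    change q ∈ segment ℝ (e.toLinearEquiv.toLinearMap.toAffineMap a)
      (e.toLinearEquiv.toLinearMap.toAffineMap b) at hq
    rw [← this] at hq
    exact hq
  refine ⟨fun v => e (p v), ⟨?_, ?_, ?_⟩, ?_⟩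
  · intro u v h
    exact Subtype.ext (hp.injective (e.injective h))
  · intro u v x huv hx
    by_contra! hne
    obtain ⟨r, hr, hrx⟩ := hseg _ _ _ hx
    have hrx := e.injective hrx
    -- The drawing condition concerns edges only, so an isolated vertex may lie on an edge. A vertex
    -- with an incident edge may not: that edge would meet `uv` outside a common end.
    obtain ⟨y, hy⟩ := x.2
    have huv' : G.Adj u v := huv
    have hedge : s((u : V), (v : V)) ≠ s((x : V), y) := by
      intro h
      have : (x : V) ∈ s((u : V), (v : V)) := by rw [h]; simp
      rcases Sym2.mem_iff.1 this with h | h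
      exacts [hne.1 (Subtype.ext h), hne.2 (Subtype.ext h)]
    obtain ⟨t, ⟨ht, -⟩, htx⟩ := hp.crossing_free u v x y huv' hy hedge
      ⟨hrx ▸ hr, left_mem_segment ℝ _ _⟩
    have := hp.injective htx
    subst this
    rcases ht with h | h
    exacts [hne.1 (Subtype.ext h), hne.2 (Subtype.ext h)]
  · intro u v x y huv hxy hne q hq1 hq2
    obtain ⟨r, hr, rfl⟩ := hseg _ _ _ hq1
    obtain ⟨r', hr', h⟩ := hseg _ _ _ hq2
    rw [e.injective h] at hr'
    have huv' : G.Adj u v := huv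
    have hxy' : G.Adj x y := hxy
    have hne' : s((u : V), (v : V)) ≠ s((x : V), (y : V)) := by
      intro h
      apply hne
      rw [Sym2.eq_iff] at h ⊢
      simpa [Subtype.ext_iff] using h
    obtain ⟨t, ⟨ht, -⟩, rfl⟩ := hp.crossing_free u v x y huv' hxy' hne' ⟨hr, hr'⟩
    rcases ht with rfl | rfl
    exacts [⟨u, rfl⟩, ⟨v, rfl⟩]
  · intro u v huv
    have := hp.unit_length u v huv
    rw [← map_sub, LinearIsometryEquiv.norm_map, ← dist_eq_norm, dist_comm]
    exact this

/-- A matchstick graph on `n` vertices has more than `√(π √3 n) / 4` vertices of degree at most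
`4`. -/
theorem IsMatchstickGraph.quarter_sqrt_lt {V : Type*} [Fintype V] [Nonempty V] {G : SimpleGraph V}
    [DecidableRel G.Adj] (hG : IsMatchstickGraph G) :
    1 / 4 * √(Real.pi * √3 * Fintype.card V) <
      (Finset.univ.filter fun v => G.degree v ≤ 4).card := by
  classical
  obtain ⟨p, hp⟩ := hG
  obtain ⟨z, hz, hunit⟩ := hp.exists_isPlaneDrawing
  have hdeg : ∀ v, ∃ w, (G.induce G.support).Adj v w := by
    rintro ⟨v, w, hvw⟩
    exact ⟨⟨w, v, hvw.symm⟩, hvw⟩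
  set n₀ := (Finset.univ.filter fun v => v ∉ G.support).card with hn₀
  have hcard : Fintype.card V = Fintype.card G.support + n₀ := by
    rw [← Finset.card_univ, ← Finset.card_filter_add_card_filter_not (s := Finset.univ)
      (fun v => v ∈ G.support), ← Fintype.card_subtype]
  have hfilter : (Finset.univ.filter fun v => G.degree v ≤ 4).card =
      (Finset.univ.filter fun v => (G.induce G.support).degree v ≤ 4).card + n₀ := by
    rw [← Finset.card_filter_add_card_filter_not (s := Finset.univ.filter fun v => G.degree v ≤ 4)
      (fun v => v ∈ G.support), Finset.filter_filter, Finset.filter_filter]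
    congr 1
    · refine (Finset.card_bij (fun v _ => v.1) ?_ ?_ ?_).symm
      · intro v hv
        simp only [Finset.mem_filter, Finset.mem_univ, true_and] at hv ⊢
        rw [SimpleGraph.degree_induce_support] at hv
        exact ⟨hv, v.2⟩
      · intro v _ w _ h
        exact Subtype.ext h
      · intro v hv
        simp only [Finset.mem_filter, Finset.mem_univ, true_and] at hv
        refine ⟨⟨v, hv.2⟩, ?_, rfl⟩
        simp only [Finset.mem_filter, Finset.mem_univ, true_and]
        rw [SimpleGraph.degree_induce_support]
        exact hv.1
    · rw [hn₀]
      congr 1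
      refine Finset.filter_congr fun v _ => ?_
      rw [and_iff_right_iff_imp]
      intro hv
      by_contra hc
      exact hv ((G.degree_pos_iff_exists_adj v).1 (by omega))
  have hsqrt : √(Real.pi * √3 * Fintype.card V) ≤
      √(Real.pi * √3 * Fintype.card G.support) + √(Real.pi * √3 * n₀) := by
    rw [hcard, Nat.cast_add, mul_add]
    rw [Real.sqrt_le_left (by positivity), add_sq,
      Real.sq_sqrt (by positivity), Real.sq_sqrt (by positivity)]
    have : 0 ≤ √(Real.pi * √3 * Fintype.card G.support) * √(Real.pi * √3 * n₀) := by positivity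
    linarith
  rw [hfilter]
  push_cast
  have h0 := quarter_sqrt_le n₀
  rcases isEmpty_or_nonempty G.support with hemp | hne
  · rw [Fintype.card_eq_zero (α := G.support), zero_add] at hcard
    have hpos : 0 < n₀ := hcard ▸ Fintype.card_pos
    have := _root_.quarter_sqrt_lt hpos
    rw [hcard]
    have hnn : (0 : ℝ) ≤ (Finset.univ.filter fun v => (G.induce G.support).degree v ≤ 4).card :=
      Nat.cast_nonneg _
    linarith
  · have := hz.quarter_sqrt_lt hunit hdeg
    linarith

/-! ### Sharpness: a piece of the triangular lattice. -/

lemma mem_segment_euclidean_iff {a b q : EuclideanSpace ℝ (Fin 2)} (h : q ∈ segment ℝ a b) :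
    ∃ s : ℝ, 0 ≤ s ∧ s ≤ 1 ∧ ∀ i, q i = (1 - s) * a i + s * b i := by
  rw [segment_eq_image] at h
  obtain ⟨s, ⟨h0, h1⟩, rfl⟩ := h
  exact ⟨s, h0, h1, fun i => by simp⟩

lemma euclidean_dist_sq (a b : EuclideanSpace ℝ (Fin 2)) :
    dist a b ^ 2 = (a 0 - b 0) ^ 2 + (a 1 - b 1) ^ 2 := by
  rw [EuclideanSpace.dist_eq, Real.sq_sqrt (by positivity), Fin.sum_univ_two, Real.dist_eq,
    Real.dist_eq, sq_abs, sq_abs]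

/-- A graph of unit distances among points with mutual distances at least `1` is a matchstick
graph. -/
lemma isMatchstickDrawing_of_one_le_dist {V : Type*} {G : SimpleGraph V}
    {p : V → EuclideanSpace ℝ (Fin 2)} (hp : ∀ u v, u ≠ v → 1 ≤ dist (p u) (p v))
    (hG : ∀ u v, G.Adj u v → dist (p u) (p v) = 1) : IsMatchstickDrawing G p := by
  have key : ∀ u v x y, G.Adj u v → G.Adj x y → v ≠ y → u ≠ y → v ≠ x →
      ∀ q ∈ segment ℝ (p u) (p v), q ∈ segment ℝ (p x) (p y) → u = x ∧ q = p u := by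
    intro u v x y huv hxy hvy huy hvx q hq1 hq2
    obtain ⟨s, hs0, hs1, hs⟩ := mem_segment_euclidean_iff hq1
    obtain ⟨t, ht0, ht1, ht⟩ := mem_segment_euclidean_iff hq2
    have e0 : (1 - s) * p u 0 + s * p v 0 = (1 - t) * p x 0 + t * p y 0 := by rw [← hs, ← ht]
    have e1 : (1 - s) * p u 1 + s * p v 1 = (1 - t) * p x 1 + t * p y 1 := by rw [← hs, ← ht]
    -- The left side minus the right side is the squared distance between the two expressions of
    -- `q`. With all four mutual distances at least 1 the left side is at least 1 while the right
    -- side is at most 1/2. Without the condition on `u` and `x`, one still gets s² + t² ≤ st, hence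
    -- s = 0.
    have identity : (1 - s) * (1 - t) * dist (p u) (p x) ^ 2 + (1 - s) * t * dist (p u) (p y) ^ 2 +
        s * (1 - t) * dist (p v) (p x) ^ 2 + s * t * dist (p v) (p y) ^ 2 =
        s * (1 - s) * dist (p u) (p v) ^ 2 + t * (1 - t) * dist (p x) (p y) ^ 2 := by
      simp only [euclidean_dist_sq]
      linear_combination ((1 - s) * p u 0 + s * p v 0 - ((1 - t) * p x 0 + t * p y 0)) * e0 +
        ((1 - s) * p u 1 + s * p v 1 - ((1 - t) * p x 1 + t * p y 1)) * e1
    rw [hG u v huv, hG x y hxy] at identity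
    have hsq : ∀ {u v}, u ≠ v → 1 ≤ dist (p u) (p v) ^ 2 := fun h => one_le_pow₀ (hp _ _ h)
    have a2 := mul_le_mul_of_nonneg_left (hsq huy) (mul_nonneg (sub_nonneg.2 hs1) ht0)
    have a3 := mul_le_mul_of_nonneg_left (hsq hvx) (mul_nonneg hs0 (sub_nonneg.2 ht1))
    have a4 := mul_le_mul_of_nonneg_left (hsq hvy) (mul_nonneg hs0 ht0)
    constructor
    · by_contra hux
      have a1 := mul_le_mul_of_nonneg_left (hsq hux)
        (mul_nonneg (sub_nonneg.2 hs1) (sub_nonneg.2 ht1))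
      nlinarith [sq_nonneg (s - 1 / 2), sq_nonneg (t - 1 / 2)]
    · have a1 : 0 ≤ (1 - s) * (1 - t) * dist (p u) (p x) ^ 2 := by
        have := sub_nonneg.2 hs1
        have := sub_nonneg.2 ht1
        positivity
      have hs : s = 0 := by
        refine pow_eq_zero_iff (two_ne_zero) |>.1 (le_antisymm ?_ (sq_nonneg s))
        nlinarith [sq_nonneg (s - t), sq_nonneg t]
      ext i
      rename_i hs'
      rw [hs' i, hs]
      ring
  refine ⟨?_, hG, ?_⟩
  · intro u v h
    by_contra hne
    have := hp u v hne
    rw [h, dist_self] at this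
    linarith
  · rintro u v x y huv hxy hne q ⟨hq1, hq2⟩
    by_cases hvy : v = y
    · have hux : u ≠ x := by rintro rfl; exact hne (by rw [hvy])
      obtain ⟨h1, h2⟩ := key v u y x huv.symm hxy.symm hux (by rw [hvy]; exact hxy.ne')
        (by rw [← hvy]; exact huv.ne) q (by rwa [segment_symm]) (by rwa [segment_symm])
      exact ⟨v, by simp [hvy], h2.symm⟩
    by_cases huy : u = y
    · have hvx : v ≠ x := by rintro rfl; exact hne (by rw [huy, Sym2.eq_swap])
      obtain ⟨h1, h2⟩ := key u v y x huv hxy.symm hvx (by rw [huy]; exact hxy.ne') hvy q hq1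
        (by rwa [segment_symm])
      exact ⟨u, by simp [huy], h2.symm⟩
    by_cases hvx : v = x
    · obtain ⟨h1, h2⟩ := key v u x y huv.symm hxy huy hvy (by rw [← hvx]; exact huv.ne) q
        (by rwa [segment_symm]) hq2
      exact ⟨v, by simp [hvx], h2.symm⟩
    obtain ⟨h1, h2⟩ := key u v x y huv hxy hvy huy hvx q hq1 hq2
    exact ⟨u, by simp [h1], h2.symm⟩

/-- The point of the triangular lattice with index `v`, in rows of length `a`. -/
noncomputable def latticePoint (a v : ℕ) : EuclideanSpace ℝ (Fin 2) :=
  !₂[((v % a : ℕ) : ℝ) + ((v / a : ℕ) : ℝ) / 2, ((v / a : ℕ) : ℝ) * (√3 / 2)]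

lemma latticePoint_dist_sq (a u v : ℕ) :
    dist (latticePoint a u) (latticePoint a v) ^ 2 =
      (((((u % a : ℕ) : ℤ) - (v % a : ℕ)) ^ 2 +
        (((u % a : ℕ) : ℤ) - (v % a : ℕ)) * (((u / a : ℕ) : ℤ) - (v / a : ℕ)) +
        (((u / a : ℕ) : ℤ) - (v / a : ℕ)) ^ 2 : ℤ) : ℝ) := by
  rw [euclidean_dist_sq]
  have h3 : √3 ^ 2 = 3 := Real.sq_sqrt (by norm_num)
  simp only [latticePoint, PiLp.toLp_apply, Matrix.cons_val_zero, Matrix.cons_val_one]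
  generalize u % a = j
  generalize u / a = i
  generalize v % a = j'
  generalize v / a = i'
  push_cast
  linear_combination ((i : ℝ) - i') ^ 2 / 4 * h3

lemma one_le_latticePoint_dist {a u v : ℕ} (h : u ≠ v) :
    1 ≤ dist (latticePoint a u) (latticePoint a v) := by
  have hsq : (1 : ℝ) ≤ dist (latticePoint a u) (latticePoint a v) ^ 2 := by
    rw [latticePoint_dist_sq, ← Int.cast_one, Int.cast_le]
    set J : ℤ := ((u % a : ℕ) : ℤ) - (v % a : ℕ) with hJ
    set I : ℤ := ((u / a : ℕ) : ℤ) - (v / a : ℕ) with hI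
    by_contra! hlt
    have h1 : 4 * (J ^ 2 + J * I + I ^ 2) = (2 * J + I) ^ 2 + 3 * I ^ 2 := by ring
    have hI0 : I = 0 := by
      by_contra hI0
      have : 1 ≤ I ^ 2 := by have := sq_pos_of_ne_zero hI0; omega
      nlinarith [sq_nonneg (2 * J + I)]
    have hJ0 : J = 0 := by
      rw [hI0] at hlt
      by_contra hJ0
      have : 1 ≤ J ^ 2 := by have := sq_pos_of_ne_zero hJ0; omega
      nlinarith
    apply h
    rw [← Nat.div_add_mod u a, ← Nat.div_add_mod v a]
    have e1 : u / a = v / a := by omega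
    have e2 : u % a = v % a := by omega
    rw [e1, e2]
  by_contra! hlt
  have := dist_nonneg (x := latticePoint a u) (y := latticePoint a v)
  nlinarith

lemma latticePoint_dist_eq_one {a u v : ℕ} {J I : ℤ} (hJ : ((u % a : ℕ) : ℤ) - (v % a : ℕ) = J)
    (hI : ((u / a : ℕ) : ℤ) - (v / a : ℕ) = I) (h : J ^ 2 + J * I + I ^ 2 = 1) :
    dist (latticePoint a u) (latticePoint a v) = 1 := by
  have hsq := latticePoint_dist_sq a u v
  rw [hJ, hI, h] at hsq
  have := dist_nonneg (x := latticePoint a u) (y := latticePoint a v)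
  push_cast at hsq
  nlinarith

/-- The unit distance graph of the first `n` lattice points. -/
noncomputable def latticeGraph (n : ℕ) : SimpleGraph (Fin n) where
  Adj u v := dist (latticePoint n.sqrt u) (latticePoint n.sqrt v) = 1
  symm := ⟨fun u v h => by rw [dist_comm]; exact h⟩
  loopless := ⟨fun u h => by simp at h⟩

lemma isMatchstickGraph_latticeGraph (n : ℕ) : IsMatchstickGraph (latticeGraph n) :=
  ⟨fun v => latticePoint n.sqrt v, isMatchstickDrawing_of_one_le_dist
    (fun _ _ h => one_le_latticePoint_dist fun h' => h (Fin.ext h')) fun _ _ h => h⟩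

lemma four_lt_degree_latticeGraph {n : ℕ} [DecidableRel (latticeGraph n).Adj] (v : Fin n)
    (h1 : n.sqrt ≤ v) (h2 : v + n.sqrt < n) (h3 : v % n.sqrt ≠ 0)
    (h4 : v % n.sqrt ≠ n.sqrt - 1) : 4 < (latticeGraph n).degree v := by
  obtain ⟨v, hv⟩ := v
  simp only at h1 h2 h3 h4
  set a := n.sqrt with ha
  have ha0 : 0 < a := Nat.pos_of_ne_zero fun h => by
    rw [Nat.sqrt_eq_zero] at h
    omega
  have hlt := Nat.mod_lt v ha0
  have hdiv := Nat.div_add_mod v a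
  obtain ⟨i, hi⟩ : ∃ i, v / a = i + 1 := Nat.exists_eq_succ_of_ne_zero
    (Nat.div_pos h1 ha0).ne'
  obtain ⟨j, hj⟩ : ∃ j, v % a = j + 1 := Nat.exists_eq_succ_of_ne_zero h3
  rw [hi, hj] at hdiv
  have hcoord : ∀ i' j', j' < a → (a * i' + j') / a = i' ∧ (a * i' + j') % a = j' := by
    intro i' j' h
    rw [Nat.mul_add_div ha0, Nat.div_eq_of_lt h, Nat.mul_add_mod, Nat.mod_eq_of_lt h]
    exact ⟨rfl, rfl⟩
  have hja : j + 2 < a := by omega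
  have e1 : a * (i + 1) = a * i + a := by ring
  have e2 : a * (i + 2) = a * i + a + a := by ring
  have hmem : ∀ i' j' : ℕ, ∀ hj' : j' < a, ∀ hn : a * i' + j' < n,
      (((j + 1 : ℕ) : ℤ) - j') ^ 2 + (((j + 1 : ℕ) : ℤ) - j') * (((i + 1 : ℕ) : ℤ) - i') +
        (((i + 1 : ℕ) : ℤ) - i') ^ 2 = 1 →
      (⟨a * i' + j', hn⟩ : Fin n) ∈ (latticeGraph n).neighborFinset ⟨v, hv⟩ := by
    intro i' j' hj' hn h
    rw [SimpleGraph.mem_neighborFinset]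
    refine latticePoint_dist_eq_one (a := a) ?_ ?_ h
    · rw [hj, (hcoord i' j' hj').2]
    · rw [hi, (hcoord i' j' hj').1]
  rw [← SimpleGraph.card_neighborFinset_eq_degree]
  -- Five of the six lattice neighbours already exceed degree 4; the sixth, one row down and one
  -- step left, is not needed.
  let s : Finset (Fin n) := {⟨a * (i + 1) + j, by omega⟩, ⟨a * (i + 1) + (j + 2), by omega⟩,
    ⟨a * i + (j + 1), by omega⟩, ⟨a * (i + 2) + (j + 1), by omega⟩, ⟨a * i + (j + 2), by omega⟩}
  have hs : s.card = 5 := by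
    rw [Finset.card_insert_of_notMem, Finset.card_insert_of_notMem, Finset.card_insert_of_notMem,
      Finset.card_insert_of_notMem, Finset.card_singleton]
    all_goals
      simp only [Finset.mem_insert, Finset.mem_singleton, Fin.mk.injEq]
      omega
  have hsub : s ⊆ (latticeGraph n).neighborFinset ⟨v, hv⟩ := by
    intro w hw
    simp only [s, Finset.mem_insert, Finset.mem_singleton] at hw
    rcases hw with rfl | rfl | rfl | rfl | rfl
    all_goals
      refine hmem _ _ (by omega) _ ?_
      push_cast
      ring
  have := Finset.card_le_card hsub
  omega

lemma card_degree_le_four_latticeGraph (n : ℕ) [DecidableRel (latticeGraph n).Adj] :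
    (Finset.univ.filter fun v => (latticeGraph n).degree v ≤ 4).card ≤ 4 * n.sqrt + 6 := by
  classical
  rcases Nat.eq_zero_or_pos n with rfl | hn
  · simp
  set a := n.sqrt with ha
  have ha0 : 0 < a := Nat.sqrt_pos.2 hn
  have hna : n ≤ a * a + a + a := Nat.sqrt_le_add n
  have hq : ∀ v : Fin n, v / a < a + 3 := by
    intro v
    rw [Nat.div_lt_iff_lt_mul ha0]
    have := v.2
    nlinarith
  -- Low degree occurs only among the first `a` and the last `a` indices and in the two end columns;
  -- the last rows may be incomplete, which is why indices are compared with `n - a` and the columns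
  -- have up to `a + 3` entries.
  have hsub : (Finset.univ.filter fun v => (latticeGraph n).degree v ≤ 4) ⊆
      ((Finset.univ.filter fun v : Fin n => (v : ℕ) < a) ∪
        (Finset.univ.filter fun v : Fin n => n ≤ v + a)) ∪
      ((Finset.univ.filter fun v : Fin n => v % a = 0) ∪
        (Finset.univ.filter fun v : Fin n => v % a = a - 1)) := by
    intro v hv
    simp only [Finset.mem_filter, Finset.mem_univ, true_and, Finset.mem_union] at hv ⊢
    by_contra! h
    exact absurd (four_lt_degree_latticeGraph v h.1.1 h.1.2 h.2.1 h.2.2) (by omega)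
  have c1 : (Finset.univ.filter fun v : Fin n => (v : ℕ) < a).card ≤ a := by
    refine (Finset.card_le_card_of_injOn (t := Finset.range a) (fun v : Fin n => (v : ℕ)) ?_
      ?_).trans_eq (Finset.card_range a)
    · intro v hv
      simpa using hv
    · intro v _ w _ h
      exact Fin.ext h
  have c2 : (Finset.univ.filter fun v : Fin n => n ≤ v + a).card ≤ a := by
    refine (Finset.card_le_card_of_injOn (t := Finset.range a) (fun v : Fin n => n - 1 - (v : ℕ)) ?_
      ?_).trans_eq (Finset.card_range a)
    · intro v hv
      simp only [Finset.coe_filter, Finset.mem_univ, true_and, Set.mem_ofPred_eq] at hv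
      simp only [Finset.coe_range, Set.mem_Iio]
      have := v.2
      omega
    · intro v _ w _ h
      simp only at h
      have := v.2
      have := w.2
      exact Fin.ext (by omega)
  have c3 : ∀ r, (Finset.univ.filter fun v : Fin n => v % a = r).card ≤ a + 3 := by
    intro r
    rw [← Finset.card_range (a + 3)]
    refine Finset.card_le_card_of_injOn (fun v => v / a) ?_ fun v hv w hw h => Fin.ext ?_
    · intro v _
      simpa using hq v
    · simp only [Finset.coe_filter, Finset.mem_univ, true_and, Set.mem_ofPred_eq] at hv hw
      rw [← Nat.div_add_mod v a, ← Nat.div_add_mod w a, hv, hw]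
      simp only at h
      rw [h]
  refine (Finset.card_le_card hsub).trans ((Finset.card_union_le _ _).trans ?_)
  have u1 := Finset.card_union_le (Finset.univ.filter fun v : Fin n => (v : ℕ) < a)
    (Finset.univ.filter fun v : Fin n => n ≤ v + a)
  have u2 := Finset.card_union_le (Finset.univ.filter fun v : Fin n => v % a = 0)
    (Finset.univ.filter fun v : Fin n => v % a = a - 1)
  have := c3 0
  have := c3 (a - 1)
  omega

theorem corollary2 :
    (∀ (V : Type*) [Fintype V] [Nonempty V] (G : SimpleGraph V) [DecidableRel G.Adj],
      IsMatchstickGraph G →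
        1 / 4 * Real.sqrt (Real.pi * Real.sqrt 3 * (Fintype.card V : ℝ)) <
          ((Finset.univ.filter fun v : V => G.degree v ≤ 4).card : ℝ)) ∧
    (∃ C : ℝ, 0 < C ∧ ∀ n : ℕ,
      ∃ (G : SimpleGraph (Fin n)) (_ : DecidableRel G.Adj), IsMatchstickGraph G ∧
        ((Finset.univ.filter fun v : Fin n => G.degree v ≤ 4).card : ℝ) ≤
          C * Real.sqrt (n : ℝ)) := by
  classical
  refine ⟨fun V _ _ G _ hG => hG.quarter_sqrt_lt, 10, by norm_num, fun n =>
    ⟨latticeGraph n, inferInstance, isMatchstickGraph_latticeGraph n, ?_⟩⟩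
  rcases Nat.eq_zero_or_pos n with rfl | hn
  · simp
  · have h1 := card_degree_le_four_latticeGraph n
    have h2 : 0 < n.sqrt := Nat.sqrt_pos.2 hn
    have h3 : (Finset.univ.filter fun v => (latticeGraph n).degree v ≤ 4).card ≤
        10 * n.sqrt := by omega
    have h4 : ((Finset.univ.filter fun v => (latticeGraph n).degree v ≤ 4).card : ℝ) ≤
        10 * n.sqrt := by exact_mod_cast h3
    have h5 : (n.sqrt : ℝ) ≤ √n := Real.nat_sqrt_le_real_sqrt
    linarith
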